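/- **Setting.** For each $n$ let $X_1,\dots,X_n$ be i.i.d. random vectors in $\mathbb R^{p}$, $p=p_n\ge 1$, with mean $\mu$, covariance matrix $\Sigma$ and precision matrix $\Omega=\Sigma^{-1}=(\omega_{ij})$ (the distribution may change with $n$); $X$ denotes a generic copy. For a $p\times p$ matrix $A=(a_{ij})$ put $\|A\|_\infty=\max_{i,j}|a_{ij}|$ and $\|A\|_{L_1}=\max_j\sum_i|a_{ij}|$. Let $\hat\Sigma_1=\frac1n\sum_{k=1}^n(X_k-\bar X)(X_k-\bar X)^{\top}$ with $\bar X=\frac1n\sum_{k=1}^nX_k$. **Estimator.** For $\lambda\ge0$ let $\hat\beta_i\in\arg\min_{\beta\in\mathbb R^p}\{\frac12\beta^{\top}\hat\Sigma_1\beta-e_i^{\top}\beta+\lambda|\beta|_1\}$, $i=1,\dots,p$, where $e_i$ is the $i$-th unit vector, and let $\hat\beta_{ij}$ be the entries of the matrix $(\hat\beta_1,\dots,\hat\beta_p)$. The SCIO estimator $\tilde\Omega_1$ is the symmetric matrix whose entry $\tilde\omega_{ij}=\tilde\omega_{ji}$ is the one of $\hat\beta_{ij},\hat\beta_{ji}$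 with the smaller absolute value (either one, if the absolute values are equal). **Assumptions.** (A1) For a given $q\in[0,1)$ and all $n$: $\Omega$ is positive definite, $\max_j\sum_i|\omega_{ij}|^q\le s_p$ (with $0^0=0$) and $\|\Omega\|_{L_1}\le M_p$, where $s_pM_p^{1-2q}=o\big((n/\log p)^{(1-q)/2}\big)$ as $n\to\infty$, that is, $s_pM_p^{1-2q}(\log p/n)^{(1-q)/2}\to0$. (A2) $\log p=o(n)$ and $\mathbb E\exp(\eta(X_i-\mu_i)^2)\le K$ for all $n$ and $1\le i\le p$, where $\eta,K>0$ are constants. (A3) $p\le c\,n^{\gamma}$ and $\mathbb E|X_i-\mu_i|^{4\gamma+4+\delta}\le K$ for all $n\ge 1$ and $1\le i\le p$, where $\gamma,c,\delta,K>0$ are constants. **Result.** Let $\tau>0$ and $\lambda=C_0M_p\sqrt{\log p/n}$, where the constant $C_0$ is sufficiently large, depending only on $\tau,\eta,K$ in case (A2) and only on $\tau,\gamma,c,\delta,K$ in case (A3). Then there are constants $C_1,C_2>0$ that depend only on $q,C_0,\eta,K$ (under (A2)), respectively only on $q,C_0,\delta,K$ (under (A3)), such that under (A1) and (A2), with probability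 at least $1-O(p^{-\tau})$, and under (A1) and (A3), with probability at least $1-O(p^{-\tau}+n^{-\delta/8})$, as $n\to\infty$, the estimator $\tilde\Omega_1$ exists and each of its versions (the minimizers $\hat\beta_i$ need not be unique) satisfies both $$\|\tilde\Omega_1-\Omega\|_\infty\le C_1M_p^2\sqrt{\frac{\log p}{n}}\qquad\text{and}\qquad \|\tilde\Omega_1-\Omega\|_{L_1}\le C_2\,s_p\,M_p^{2-2q}\Big(\frac{\log p}{n}\Big)^{\frac{1-q}2}.$$ -/

import Mathlib

open MeasureTheory ProbabilityTheory Filter Asymptotics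

noncomputable section

namespace SCIO

/-- The element-wise maximum norm of a square matrix. -/
def maxNorm {p : ℕ} (A : Matrix (Fin p) (Fin p) ℝ) : ℝ :=
  ⨆ i, ⨆ j, |A i j|

/-- The matrix `ℓ₁` norm: the largest absolute column sum. -/
def l1Norm {p : ℕ} (A : Matrix (Fin p) (Fin p) ℝ) : ℝ :=
  ⨆ j, ∑ i, |A i j|

/-- `|x| ^ q` with the convention `0 ^ 0 = 0`, so that for `q = 0` it is the indicator
of `x ≠ 0` and its sum over a column counts the nonzero entries. -/
def absPow (q x : ℝ) : ℝ :=
  if x = 0 then 0 else |x| ^ q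

/-- The class `𝒰_q(s, M)` of positive definite matrices that are weakly `ℓ_q` sparse. -/
structure MemSparseClass {p : ℕ} (q s M : ℝ) (A : Matrix (Fin p) (Fin p) ℝ) : Prop where
  posDef : A.PosDef
  colSparse : ∀ j, ∑ i, absPow q (A i j) ≤ s
  l1Norm_le : l1Norm A ≤ M

/-- The mean vector of the distribution `ν` on `ℝ^p`. -/
def mean {p : ℕ} (ν : Measure (Fin p → ℝ)) (i : Fin p) : ℝ :=
  ∫ x, x i ∂ν

/-- The population covariance matrix of the distribution `ν` on `ℝ^p`. -/
def popCov {p : ℕ} (ν : Measure (Fin p → ℝ)) : Matrix (Fin p) (Fin p) ℝ :=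
  Matrix.of fun i j => covariance (fun x : Fin p → ℝ => x i) (fun x : Fin p → ℝ => x j) ν

/-- The precision matrix, the inverse of the population covariance matrix. -/
def precision {p : ℕ} (ν : Measure (Fin p → ℝ)) : Matrix (Fin p) (Fin p) ℝ :=
  (popCov ν)⁻¹

/-- The sample mean of `n` observations in `ℝ^p`. -/
def sampleMean {n p : ℕ} (x : Fin n → Fin p → ℝ) (i : Fin p) : ℝ :=
  (∑ k, x k i) / n

/-- The sample covariance matrix `n⁻¹ ∑ₖ (xₖ - x̄)(xₖ - x̄)ᵀ`. -/
def sampleCov {n p : ℕ} (x : Fin n → Fin p → ℝ) : Matrix (Fin p) (Fin p) ℝ :=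
  Matrix.of fun i j => (∑ k, (x k i - sampleMean x i) * (x k j - sampleMean x j)) / n

/-- The objective `½ βᵀ S β - eᵢᵀ β + lam |β|₁` of the `i`-th column problem. -/
def objective {p : ℕ} (S : Matrix (Fin p) (Fin p) ℝ) (lam : ℝ) (i : Fin p)
    (β : Fin p → ℝ) : ℝ :=
  1 / 2 * (β ⬝ᵥ S.mulVec β) - β i + lam * ∑ j, |β j|

/-- The columns of `B` are minimizers of the column problems. -/
def IsColumnwiseMin {p : ℕ} (S : Matrix (Fin p) (Fin p) ℝ) (lam : ℝ)
    (B : Matrix (Fin p) (Fin p) ℝ) : Prop :=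
  ∀ i, IsMinOn (objective S lam i) Set.univ (fun r => B r i)

/-- `W` is the symmetrization of `B` that keeps, of `B i j` and `B j i`, the one with the smaller
absolute value. If both have the same absolute value, either may be kept. -/
def IsSymmetrization {p : ℕ} (B W : Matrix (Fin p) (Fin p) ℝ) : Prop :=
  W.IsSymm ∧ ∀ i j, (|B i j| ≤ |B j i| ∧ W i j = B i j) ∨ (|B j i| ≤ |B i j| ∧ W i j = B j i)

/-- `W` is a SCIO estimate with pilot covariance estimate `S` and tuning parameter `lam`. -/
def IsEstimate {p : ℕ} (S : Matrix (Fin p) (Fin p) ℝ) (lam : ℝ)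
    (W : Matrix (Fin p) (Fin p) ℝ) : Prop :=
  ∃ B, IsColumnwiseMin S lam B ∧ IsSymmetrization B W

/-- A SCIO estimate exists, and every SCIO estimate (the minimizers need not be unique) is within
`b₁` of `A` in the element-wise maximum norm and within `b₂` in the matrix `ℓ₁` norm. -/
def ErrorBounds {p : ℕ} (S : Matrix (Fin p) (Fin p) ℝ) (lam : ℝ)
    (A : Matrix (Fin p) (Fin p) ℝ) (b₁ b₂ : ℝ) : Prop :=
  (∃ W, IsEstimate S lam W) ∧
    ∀ W, IsEstimate S lam W → maxNorm (W - A) ≤ b₁ ∧ l1Norm (W - A) ≤ b₂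

/-- `X₁, …, Xₙ` are independent with common distribution `ν`. -/
structure IsIIDSample {Ω : Type*} [MeasurableSpace Ω] {n p : ℕ} (P : Measure Ω)
    (ν : Measure (Fin p → ℝ)) (X : Fin n → Ω → Fin p → ℝ) : Prop where
  law : ∀ k, HasLaw (X k) ν P
  indep : iIndepFun X P

/-- Sparsity restriction: the precision matrices are in `𝒰_q(s, M)` and
`s M ^ (1 - 2q) = o((n / log p) ^ ((1 - q) / 2))`; the quotient of the two sides is written with
`log p / n`, which is meaningful for `p = 1` too. -/
structure SparsityCondition (q : ℝ) (p : ℕ → ℕ) (s M : ℕ → ℝ)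
    (ν : ∀ n, Measure (Fin (p n) → ℝ)) : Prop where
  mem : ∀ n, MemSparseClass q (s n) (M n) (precision (ν n))
  small : Tendsto
    (fun n : ℕ => s n * M n ^ (1 - 2 * q) * (Real.log (p n) / n) ^ ((1 - q) / 2)) atTop (nhds 0)

/-- Exponential-type tails. -/
structure ExpTails (η K : ℝ) (p : ℕ → ℕ) (ν : ∀ n, Measure (Fin (p n) → ℝ)) : Prop where
  log_dim : (fun n : ℕ => Real.log (p n)) =o[atTop] (fun n : ℕ => (n : ℝ))
  integrable : ∀ n i, Integrable (fun x => Real.exp (η * (x i - mean (ν n) i) ^ 2)) (ν n)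
  moment : ∀ n i, ∫ x, Real.exp (η * (x i - mean (ν n) i) ^ 2) ∂(ν n) ≤ K

/-- Polynomial-type tails. -/
structure PolyTails (γ c δ K : ℝ) (p : ℕ → ℕ) (ν : ∀ n, Measure (Fin (p n) → ℝ)) : Prop where
  dim : ∀ n : ℕ, 1 ≤ n → (p n : ℝ) ≤ c * (n : ℝ) ^ γ
  integrable : ∀ n i, Integrable (fun x => |x i - mean (ν n) i| ^ (4 * γ + 4 + δ)) (ν n)
  moment : ∀ n i, ∫ x, |x i - mean (ν n) i| ^ (4 * γ + 4 + δ) ∂(ν n) ≤ K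

end SCIO

end

/-! The argument separates into a deterministic part and a concentration part. Write `S` for the
sample covariance, `V` for the covariance, `A` for its inverse, and r = √(log p / n).

Deterministic part (`errorBounds_of_close`). Suppose every entry of `S - V` is at most a constant
times r. Each column β of `A` then nearly solves its own problem: Sβ - eᵢ = (S - V)β has entries of
order M r, at most lam / 2. Comparing objectives puts the error d of a minimizer in a cone
(`l1_error_le`), so its ℓ₁ norm is governed by the few coordinates where β is large. Since d =
A(Vd), and Vd consists of two residuals of order lam plus (V - S)d, the maximum error is at most a
multiple of M lam plus M r times the ℓ₁ error. The ℓ₁ error is in turn bounded by the sparsity times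
the maximum error, and the sparsity condition makes this loop contract (`column_error_le`). No
restricted eigenvalue condition is needed.

Concentration part (`measure_sampleCov_deviation_le`). A Chernoff bound with exponential parameter r
and a union bound over the p² entries give the required closeness. Exponential tails allow it
directly; polynomial tails require truncating the coordinates at level r^(-1/2), where bias,
exponential moments and tail probability balance. -/

namespace SCIO

open Matrix

/-! ### Deterministic analysis of the column problems and of the symmetrization -/

section Deterministic

variable {p : ℕ}

/-- Expansion of the objective around a point. -/
theorem objective_add {S : Matrix (Fin p) (Fin p) ℝ} (hS : S.IsSymm) (lam : ℝ) (i : Fin p)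
    (β d : Fin p → ℝ) :
    objective S lam i (β + d) = objective S lam i β + (d ⬝ᵥ S *ᵥ β - d i)
      + 1 / 2 * (d ⬝ᵥ S *ᵥ d) + lam * (∑ j, |β j + d j| - ∑ j, |β j|) := by
  have h : β ⬝ᵥ S *ᵥ d = d ⬝ᵥ S *ᵥ β := by
    rw [dotProduct_mulVec, ← mulVec_transpose, hS.eq, dotProduct_comm]
  simp only [objective, mulVec_add, dotProduct_add, add_dotProduct, Pi.add_apply, h]
  ring

/-- First-order optimality: the residual of a minimizer is at most `lam` in each coordinate. -/
theorem abs_residual_le_of_isMinOn {S : Matrix (Fin p) (Fin p) ℝ} (hS : S.IsSymm) {lam : ℝ}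
    (hlam : 0 ≤ lam) {i : Fin p} {β : Fin p → ℝ}
    (hβ : IsMinOn (objective S lam i) Set.univ β) (j : Fin p) :
    |(S *ᵥ β) j - (Pi.single j 1 : Fin p → ℝ) i| ≤ lam := by
  set g := (S *ᵥ β) j - (Pi.single j 1 : Fin p → ℝ) i with hg
  -- Compare `β` with its perturbation by `t` in coordinate `j`; the penalty grows by at most `lam *
  -- |t|`.
  have key : ∀ t : ℝ, 0 ≤ t * g + 1 / 2 * t ^ 2 * S j j + lam * |t| := by
    intro t
    have h1 := hβ (Set.mem_univ (β + t • Pi.single j 1))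
    simp only [Set.mem_ofPred_eq] at h1
    rw [objective_add hS] at h1
    have h2 : ∑ k, |β k + (t • (Pi.single j 1 : Fin p → ℝ)) k| - ∑ k, |β k| ≤ |t| := by
      rw [← Finset.sum_sub_distrib]
      calc _ ≤ ∑ k, |t| * (Pi.single j 1 : Fin p → ℝ) k := by
            refine Finset.sum_le_sum fun k _ => ?_
            have h3 : |(t • (Pi.single j 1 : Fin p → ℝ)) k|
                = |t| * (Pi.single j 1 : Fin p → ℝ) k := by
              by_cases h : k = j
              · subst h; simp
              · simp [h]
            linarith [abs_add_le (β k) ((t • (Pi.single j 1 : Fin p → ℝ)) k)]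
        _ = |t| := by rw [← Finset.mul_sum]; simp
    have h4 : (t • (Pi.single j 1 : Fin p → ℝ)) ⬝ᵥ S *ᵥ β = t * (S *ᵥ β) j := by simp
    have h5 : (t • (Pi.single j 1 : Fin p → ℝ)) ⬝ᵥ S *ᵥ (t • (Pi.single j 1 : Fin p → ℝ))
        = t ^ 2 * S j j := by
      simp [mulVec_smul]; ring
    rw [h4, h5] at h1
    have h6 := mul_le_mul_of_nonneg_left h2 hlam
    have h7 : t * g = t * (S *ᵥ β) j - (t • (Pi.single j 1 : Fin p → ℝ)) i := by
      simp [hg]; ring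
    linarith
  -- Dividing by `t` and letting `t → 0` removes the quadratic term; a single explicit `t` replaces
  -- the limit.
  have lim : ∀ x c : ℝ, (∀ t, 0 < t → t * x ≤ 1 / 2 * t ^ 2 * c + lam * t) → x ≤ lam := by
    intro x c h
    by_contra! hx
    have hc : 0 < |c| + 1 := by positivity
    have ht : 0 < (x - lam) / (|c| + 1) := div_pos (by linarith) hc
    have h1 := h _ ht
    set t := (x - lam) / (|c| + 1) with ht'
    have h2 : x - lam = t * (|c| + 1) := by rw [ht']; field_simp
    have h3 : x ≤ 1 / 2 * t * c + lam := by
      have : t * x ≤ t * (1 / 2 * t * c + lam) := by linarith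
      exact le_of_mul_le_mul_left this ht
    nlinarith [mul_le_mul_of_nonneg_left (le_abs_self c) ht.le, mul_nonneg ht.le (abs_nonneg c)]
  rw [abs_le]
  constructor
  · refine neg_le.mp (lim (-g) (S j j) fun t ht => ?_)
    have := key t
    rw [abs_of_pos ht] at this
    linarith
  · refine lim g (S j j) fun t ht => ?_
    have := key (-t)
    rw [abs_neg, abs_of_pos ht] at this
    linarith

theorem abs_dotProduct_le {d v : Fin p → ℝ} {b : ℝ} (hv : ∀ j, |v j| ≤ b) :
    |d ⬝ᵥ v| ≤ b * ∑ j, |d j| := by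
  rw [dotProduct, Finset.mul_sum]
  refine (Finset.abs_sum_le_sum_abs _ _).trans (Finset.sum_le_sum fun j _ => ?_)
  rw [abs_mul, mul_comm]
  exact mul_le_mul_of_nonneg_right (hv j) (abs_nonneg _)

theorem continuous_objective (S : Matrix (Fin p) (Fin p) ℝ) (lam : ℝ) (i : Fin p) :
    Continuous (objective S lam i) := by
  unfold objective dotProduct mulVec dotProduct
  fun_prop

/-- Near-feasibility of some vector `β` makes the objective coercive. -/
theorem exists_isMinOn_objective {S : Matrix (Fin p) (Fin p) ℝ} (hS : S.IsSymm)
    (hpos : ∀ v, 0 ≤ v ⬝ᵥ S *ᵥ v) {lam : ℝ} (hlam : 0 < lam) {i : Fin p} {β : Fin p → ℝ}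
    (hβ : ∀ j, |(S *ᵥ β) j - (Pi.single j 1 : Fin p → ℝ) i| ≤ lam / 2) :
    ∃ b, IsMinOn (objective S lam i) Set.univ b := by
  -- Near-feasibility costs at most `lam / 2` times the ℓ₁ norm of `d`, while the penalty gains
  -- `lam` times it up to a constant. The surplus gives coercivity even when `S` is singular.
  have lower : ∀ d, objective S lam i β + lam / 2 * ∑ j, |d j| - 2 * lam * ∑ j, |β j|
      ≤ objective S lam i (β + d) := by
    intro d
    rw [objective_add hS]
    have h1 : d ⬝ᵥ S *ᵥ β - d i
        = d ⬝ᵥ fun j => (S *ᵥ β) j - (Pi.single j 1 : Fin p → ℝ) i := by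
      simp [dotProduct, mul_sub, Finset.sum_sub_distrib, Pi.single_apply]
    have h2 := (abs_le.mp (abs_dotProduct_le (d := d) hβ)).1
    have h3 : ∑ j, |d j| - ∑ j, |β j| ≤ ∑ j, |β j + d j| := by
      rw [← Finset.sum_sub_distrib]
      refine Finset.sum_le_sum fun j _ => ?_
      have := abs_add_le (β j + d j) (-β j)
      rw [abs_neg, add_comm (β j), add_neg_cancel_right, add_comm (d j)] at this
      linarith
    rw [h1]
    nlinarith [hpos d, mul_le_mul_of_nonneg_left h3 hlam.le]
  have tend : Tendsto (fun d : Fin p → ℝ => objective S lam i (β + d))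
      (cocompact (Fin p → ℝ)) atTop := by
    have h : Tendsto (fun d : Fin p → ℝ => objective S lam i β
        + lam / 2 * ‖d‖ - 2 * lam * ∑ j, |β j|) (cocompact (Fin p → ℝ)) atTop := by
      refine tendsto_atTop_add_const_right _ _ (tendsto_atTop_add_const_left _ _ ?_)
      exact (tendsto_norm_cocompact_atTop).const_mul_atTop (by positivity)
    refine tendsto_atTop_mono (fun d => ?_) h
    refine le_trans ?_ (lower d)
    have h1 : ‖d‖ ≤ ∑ j, |d j| := by
      refine (pi_norm_le_iff_of_nonneg (Finset.sum_nonneg fun _ _ => abs_nonneg _)).mpr fun j => ?_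
      exact Finset.single_le_sum (f := fun j => |d j|) (fun _ _ => abs_nonneg _)
        (Finset.mem_univ j)
    have := mul_le_mul_of_nonneg_left h1 (half_pos hlam).le
    linarith
  have hc : Continuous fun d : Fin p → ℝ => objective S lam i (β + d) :=
    (continuous_objective S lam i).comp (continuous_const.add continuous_id)
  obtain ⟨d, hd⟩ := hc.exists_forall_le tend
  refine ⟨β + d, fun v _ => ?_⟩
  have := hd (v - β)
  simpa using this

/-- A minimizer is in an approximate cone around any nearly feasible vector. -/
theorem l1_error_le {S : Matrix (Fin p) (Fin p) ℝ} (hS : S.IsSymm)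
    (hpos : ∀ v, 0 ≤ v ⬝ᵥ S *ᵥ v) {lam : ℝ} (hlam : 0 < lam) {i : Fin p} {β b : Fin p → ℝ}
    (hβ : ∀ j, |(S *ᵥ β) j - (Pi.single j 1 : Fin p → ℝ) i| ≤ lam / 2)
    (hb : IsMinOn (objective S lam i) Set.univ b) (T : Finset (Fin p)) :
    ∑ j, |b j - β j| ≤ 4 * ∑ j ∈ T, |b j - β j| + 4 * ∑ j ∈ Tᶜ, |β j| := by
  have h0 := hb (Set.mem_univ β)
  simp only [Set.mem_ofPred_eq] at h0
  have hbd : b = β + (b - β) := by simp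
  rw [hbd, objective_add hS] at h0
  set d := b - β with hd
  have h1 : d ⬝ᵥ S *ᵥ β - d i
      = d ⬝ᵥ fun j => (S *ᵥ β) j - (Pi.single j 1 : Fin p → ℝ) i := by
    simp [dotProduct, mul_sub, Finset.sum_sub_distrib, Pi.single_apply]
  have h2 := (abs_le.mp (abs_dotProduct_le (d := d) hβ)).1
  rw [h1] at h0
  have hdj : ∀ j, b j - β j = d j := fun j => rfl
  simp only [hdj]
  have h3 : ∑ j, |β j + d j| - ∑ j, |β j| ≤ 1 / 2 * ∑ j, |d j| := by
    have : lam * (∑ j, |β j + d j| - ∑ j, |β j|) ≤ lam * (1 / 2 * ∑ j, |d j|) := by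
      nlinarith [hpos d]
    exact le_of_mul_le_mul_left this hlam
  -- On `T` the penalty drops by at most |d|; off `T` it rises by at least |d| - 2|β|. Inserting
  -- both into `h3` and absorbing half of the ℓ₁ norm of `d` gives the factors 4.
  have hT : ∑ j ∈ T, |β j| - ∑ j ∈ T, |d j| ≤ ∑ j ∈ T, |β j + d j| := by
    rw [← Finset.sum_sub_distrib]
    refine Finset.sum_le_sum fun j _ => ?_
    have := abs_sub_abs_le_abs_sub (β j) (-d j)
    rw [abs_neg, sub_neg_eq_add] at this
    exact this
  have hTc : ∑ j ∈ Tᶜ, |d j| - ∑ j ∈ Tᶜ, |β j| ≤ ∑ j ∈ Tᶜ, |β j + d j| := by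
    rw [← Finset.sum_sub_distrib]
    refine Finset.sum_le_sum fun j _ => ?_
    have := abs_sub_abs_le_abs_sub (d j) (-β j)
    rw [abs_neg, sub_neg_eq_add, add_comm (d j)] at this
    exact this
  have s1 := Finset.sum_add_sum_compl T fun j => |d j|
  have s2 := Finset.sum_add_sum_compl T fun j => |β j|
  have s3 := Finset.sum_add_sum_compl T fun j => |β j + d j|
  linarith

/-- Thresholding a weakly `ℓ_q` sparse vector: few large entries, small remainder. -/
theorem card_and_sum_le_of_absPow {q s t : ℝ} (hq0 : 0 ≤ q) (hq1 : q < 1) (ht : 0 < t)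
    {b : Fin p → ℝ} (hb : ∑ j, absPow q (b j) ≤ s) :
    ((Finset.univ.filter fun j => t < |b j|).card : ℝ) ≤ s * t ^ (-q) ∧
      ∑ j ∈ (Finset.univ.filter fun j => t < |b j|)ᶜ, |b j| ≤ s * t ^ (-q) * t := by
  have hnn : ∀ j, 0 ≤ absPow q (b j) := fun j => by
    unfold absPow; split_ifs <;> positivity
  have htq : 0 < t ^ q := Real.rpow_pos_of_pos ht q
  constructor
  · rw [Real.rpow_neg ht.le, ← div_eq_mul_inv, le_div_iff₀ htq, ← nsmul_eq_mul]
    refine le_trans ?_ hb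
    refine le_trans (Finset.card_nsmul_le_sum _ (fun j => absPow q (b j)) _ fun j hj => ?_)
      (Finset.sum_le_sum_of_subset_of_nonneg (Finset.subset_univ _) fun j _ _ => hnn j)
    have hj' : t < |b j| := by simpa using hj
    have : b j ≠ 0 := abs_pos.mp (ht.trans hj')
    rw [absPow, if_neg this]
    exact Real.rpow_le_rpow ht.le hj'.le hq0
  · have ht1 : t ^ (-q) * t = t ^ (1 - q) := by
      rw [sub_eq_neg_add, Real.rpow_add ht, Real.rpow_one]
    rw [mul_assoc, ht1]
    have hp : 0 ≤ t ^ (1 - q) := (Real.rpow_pos_of_pos ht _).le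
    refine le_trans ?_ (mul_le_mul_of_nonneg_right hb hp)
    rw [Finset.sum_mul]
    refine le_trans (Finset.sum_le_sum fun j hj => ?_)
      (Finset.sum_le_sum_of_subset_of_nonneg (Finset.subset_univ _)
        fun j _ _ => mul_nonneg (hnn j) hp)
    have hj' : |b j| ≤ t := by simpa using hj
    by_cases h0 : b j = 0
    · simp [h0, absPow]
    · rw [absPow, if_neg h0]
      have hpos := abs_pos.mpr h0
      calc |b j| = |b j| ^ q * |b j| ^ (1 - q) := by
            rw [← Real.rpow_add hpos]; simp
        _ ≤ _ := by
            gcongr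

theorem isSymm_sampleCov {n : ℕ} (x : Fin n → Fin p → ℝ) : (sampleCov x).IsSymm := by
  ext i j
  simp [sampleCov, mul_comm]

theorem dotProduct_sampleCov_nonneg {n : ℕ} (x : Fin n → Fin p → ℝ) (v : Fin p → ℝ) :
    0 ≤ v ⬝ᵥ sampleCov x *ᵥ v := by
  set D : Matrix (Fin n) (Fin p) ℝ := of fun k i => x k i - sampleMean x i
  have h : sampleCov x = (n : ℝ)⁻¹ • (Dᵀ * D) := by
    ext i j
    simp [sampleCov, D, mul_apply, div_eq_inv_mul]
  rw [h, smul_mulVec, dotProduct_smul, ← mulVec_mulVec, dotProduct_mulVec, vecMul_transpose,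
    smul_eq_mul]
  exact mul_nonneg (by positivity) (Finset.sum_nonneg fun _ _ => mul_self_nonneg _)

/-- On ties, positions (i, j) and (j, i) must make the same choice, so the entry above the diagonal
is taken. -/
theorem exists_isSymmetrization (B : Matrix (Fin p) (Fin p) ℝ) : ∃ W, IsSymmetrization B W := by
  refine ⟨of fun i j => if |B i j| < |B j i| then B i j else if |B j i| < |B i j| then B j i
    else B (min i j) (max i j), ?_, fun i j => ?_⟩
  · ext i j
    simp only [transpose_apply, of_apply, min_comm j i, max_comm j i]
    split_ifs <;> first | rfl | (exfalso; linarith)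
  · simp only [of_apply]
    split_ifs with h1 h2
    · exact Or.inl ⟨h1.le, rfl⟩
    · exact Or.inr ⟨h2.le, rfl⟩
    · rcases le_total i j with h | h
      · left; simp [h]; linarith
      · right; simp [h]; linarith

theorem MemSparseClass.sum_abs_le {q s M : ℝ} {A : Matrix (Fin p) (Fin p) ℝ}
    (h : MemSparseClass q s M A) (j : Fin p) : ∑ i, |A i j| ≤ M :=
  (le_ciSup (f := fun j => ∑ i, |A i j|) (Set.finite_range _).bddAbove j).trans h.l1Norm_le

theorem MemSparseClass.isSymm {q s M : ℝ} {A : Matrix (Fin p) (Fin p) ℝ}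
    (h : MemSparseClass q s M A) : A.IsSymm := by
  have := h.posDef.isHermitian
  rwa [IsHermitian, conjTranspose_eq_transpose_of_trivial] at this

theorem MemSparseClass.bound_pos {q s M : ℝ} {A : Matrix (Fin p) (Fin p) ℝ}
    (h : MemSparseClass q s M A) (hp : 1 ≤ p) : 0 < M := by
  let j : Fin p := ⟨0, hp⟩
  have h1 : 0 < A j j := h.posDef.diag_pos
  have h2 := Finset.single_le_sum (f := fun i => |A i j|) (fun _ _ => abs_nonneg _)
    (Finset.mem_univ j)
  linarith [h.sum_abs_le j, le_abs_self (A j j)]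

theorem MemSparseClass.sparsity_nonneg {q s M : ℝ} {A : Matrix (Fin p) (Fin p) ℝ}
    (h : MemSparseClass q s M A) (hp : 1 ≤ p) : 0 ≤ s := by
  refine le_trans (Finset.sum_nonneg fun i _ => ?_) (h.colSparse ⟨0, hp⟩)
  unfold absPow; split_ifs <;> positivity

/-- Columnwise error bounds for the minimizers. -/
theorem column_error_le {S V A : Matrix (Fin p) (Fin p) ℝ} (hS : S.IsSymm)
    (hpos : ∀ v, 0 ≤ v ⬝ᵥ S *ᵥ v) {q s M ε lam t D : ℝ} (hq0 : 0 ≤ q) (hq1 : q < 1)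
    (hA : MemSparseClass q s M A) (hAV : A * V = 1) (hM : 0 < M) (ht : 0 < t) (hlam : 0 < lam)
    (hε : 0 ≤ ε) (hclose : ∀ i j, |S i j - V i j| ≤ ε) {i : Fin p}
    (hβ : ∀ j, |(S *ᵥ fun k => A k i) j - (Pi.single j 1 : Fin p → ℝ) i| ≤ lam / 2)
    (hsmall : M * ε * (4 * (s * t ^ (-q))) ≤ 1 / 2) (hD : 3 * M * lam ≤ D * t) {b : Fin p → ℝ}
    (hb : IsMinOn (objective S lam i) Set.univ b) :
    (∀ j, |b j - A j i| ≤ (D + 1) * t) ∧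
      ∑ j, |b j - A j i| ≤ 4 * (s * t ^ (-q)) * ((D + 2) * t) := by
  obtain ⟨hcard, hrest⟩ := card_and_sum_le_of_absPow hq0 hq1 ht (hA.colSparse i)
  set T := Finset.univ.filter fun j => t < |A j i| with hTdef
  set N := s * t ^ (-q)
  have hN : 0 ≤ N := le_trans (Nat.cast_nonneg _) hcard
  have cone := l1_error_le hS hpos hlam hβ hb T
  -- The cone condition turns a maximum bound into an ℓ₁ bound: at most `N` coordinates are large,
  -- and the others contribute at most `N * t`.
  have l1 : ∀ H, (∀ j, |b j - A j i| ≤ H) → ∑ j, |b j - A j i| ≤ 4 * N * (H + t) := by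
    intro H hH
    have h1 : ∑ j ∈ T, |b j - A j i| ≤ N * H := by
      refine (Finset.sum_le_card_nsmul _ _ H fun j _ => hH j).trans ?_
      rw [nsmul_eq_mul]
      exact mul_le_mul_of_nonneg_right hcard ((abs_nonneg _).trans (hH i))
    linarith
  obtain ⟨j₀, -, hj₀⟩ := Finset.exists_max_image Finset.univ (fun j => |b j - A j i|) ⟨i, by simp⟩
  have l1H := l1 _ fun j => hj₀ j (Finset.mem_univ j)
  set H := |b j₀ - A j₀ i| with hH
  set d : Fin p → ℝ := fun k => b k - A k i with hd
  -- Vd is the residual of `b` (at most `lam`) minus that of the true column (at most `lam / 2`)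
  -- minus (S - V)d.
  have hVd : ∀ j, |(V *ᵥ d) j| ≤ 3 / 2 * lam + ε * ∑ k, |d k| := by
    intro j
    have e1 : (V *ᵥ d) j = ((S *ᵥ b) j - (Pi.single j 1 : Fin p → ℝ) i)
        - ((S *ᵥ fun k => A k i) j - (Pi.single j 1 : Fin p → ℝ) i)
        - d ⬝ᵥ (fun k => S j k - V j k) := by
      have : d = b - fun k => A k i := rfl
      have h2 : (S *ᵥ d) j = (S *ᵥ b) j - (S *ᵥ fun k => A k i) j := by
        rw [this, mulVec_sub]; rfl
      have h3 : d ⬝ᵥ (fun k => S j k - V j k) = (S *ᵥ d) j - (V *ᵥ d) j := by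
        simp only [dotProduct, mulVec, mul_comm (d _), sub_mul, Finset.sum_sub_distrib]
      rw [h3, h2]; ring
    rw [e1]
    have k1 := abs_residual_le_of_isMinOn hS hlam.le hb j
    have k2 := hβ j
    have k3 := abs_dotProduct_le (d := d) (fun k => hclose j k)
    have k4 := abs_sub (((S *ᵥ b) j - (Pi.single j 1 : Fin p → ℝ) i)
        - ((S *ᵥ fun k => A k i) j - (Pi.single j 1 : Fin p → ℝ) i))
        (d ⬝ᵥ (fun k => S j k - V j k))
    have k5 := abs_sub ((S *ᵥ b) j - (Pi.single j 1 : Fin p → ℝ) i)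
        ((S *ᵥ fun k => A k i) j - (Pi.single j 1 : Fin p → ℝ) i)
    linarith
  -- Since d = A(Vd), a bound on the entries of Vd costs a factor `M`; symmetry of `A` turns its
  -- column sums into row sums.
  have hHle : H ≤ M * (3 / 2 * lam + ε * ∑ k, |d k|) := by
    have e : d j₀ = (fun k => A k j₀) ⬝ᵥ (V *ᵥ d) := by
      have h1 : d = A *ᵥ (V *ᵥ d) := by rw [mulVec_mulVec, hAV, one_mulVec]
      conv_lhs => rw [h1]
      simp only [mulVec, dotProduct]
      refine Finset.sum_congr rfl fun k _ => ?_
      rw [hA.isSymm.apply]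
    have h2 := abs_dotProduct_le (d := fun k => A k j₀) hVd
    rw [← e] at h2
    refine (show H = |d j₀| from rfl) ▸ h2.trans ?_
    rw [mul_comm]
    refine mul_le_mul_of_nonneg_right (hA.sum_abs_le j₀) ?_
    have := Finset.sum_nonneg fun k (_ : k ∈ Finset.univ) => abs_nonneg (d k)
    positivity
  have hHt : 0 ≤ H + t := add_nonneg (abs_nonneg _) ht.le
  -- The loop closes: `hsmall` gives H ≤ (3/2) M lam + (H + t)/2, and the H on the right is
  -- absorbed.
  have hfin : H ≤ (D + 1) * t := by
    have h1 : M * (ε * ∑ k, |d k|) ≤ M * ε * (4 * N) * (H + t) := by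
      have := mul_le_mul_of_nonneg_left l1H (mul_nonneg hM.le hε)
      linarith
    have h2 := mul_le_mul_of_nonneg_right hsmall hHt
    linarith
  refine ⟨fun j => (hj₀ j (Finset.mem_univ j)).trans hfin, l1H.trans ?_⟩
  refine mul_le_mul_of_nonneg_left (by linarith) (by positivity)

/-- On the event that the pilot estimate is entrywise close to the covariance matrix, the
estimator exists and satisfies both error bounds. -/
theorem errorBounds_of_close {S V A : Matrix (Fin p) (Fin p) ℝ} (hp : 1 ≤ p) (hS : S.IsSymm)
    (hpos : ∀ v, 0 ≤ v ⬝ᵥ S *ᵥ v) {q s M L C : ℝ} (hq0 : 0 ≤ q) (hq1 : q < 1)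
    (hA : MemSparseClass q s M A) (hAV : A * V = 1) (hL : 0 < L) (hC : 0 < C)
    (hclose : ∀ i j, |S i j - V i j| ≤ C / 2 * √L)
    (hsmall : 2 * C * (s * M ^ (1 - 2 * q) * L ^ ((1 - q) / 2)) ≤ 1 / 2) :
    ErrorBounds S (C * M * √L) A ((3 * C + 1) * M ^ 2 * √L)
      ((15 * C + 11) * s * M ^ (2 - 2 * q) * L ^ ((1 - q) / 2)) := by
  have hM := hA.bound_pos hp
  have hs := hA.sparsity_nonneg hp
  set r := √L with hr
  have hr0 : 0 < r := Real.sqrt_pos.mpr hL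
  have hLr : L ^ ((1 - q) / 2) = r ^ (1 - q) := by
    rw [hr, Real.sqrt_eq_rpow, ← Real.rpow_mul hL.le]; congr 1; ring
  rw [hLr] at hsmall ⊢
  -- The threshold is taken at the order of the maximum error, so `M * lam = C * t`, and `D = 3 * C`
  -- will serve in `column_error_le`.
  set t := M ^ 2 * r with ht
  have ht0 : 0 < t := by positivity
  have hlam : 0 < C * M * r := by positivity
  have htq : t ^ (-q) = M ^ (-2 * q) * r ^ (-q) := by
    rw [ht, Real.mul_rpow (by positivity) hr0.le, ← Real.rpow_natCast, ← Real.rpow_mul hM.le]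
    congr 2; push_cast; ring
  have hr1 : r ^ (1 - q) = r * r ^ (-q) := by
    rw [sub_eq_add_neg, Real.rpow_add hr0, Real.rpow_one]
  have hN1 : M * (C / 2 * r) * (4 * (s * t ^ (-q))) ≤ 1 / 2 := by
    have : M ^ (1 - 2 * q) = M * M ^ (-2 * q) := by
      rw [sub_eq_add_neg, Real.rpow_add hM, Real.rpow_one]; congr 2; ring
    rw [this, hr1] at hsmall
    rw [htq]
    linarith
  have hN2 : s * t ^ (-q) * t = s * M ^ (2 - 2 * q) * r ^ (1 - q) := by
    have : M ^ (2 - 2 * q) = M ^ 2 * M ^ (-2 * q) := by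
      rw [← Real.rpow_natCast M 2, ← Real.rpow_add hM]; congr 1; push_cast; ring
    rw [htq, this, hr1, ht]; ring
  have hVA : V * A = 1 := mul_eq_one_comm.mp hAV
  have hβ : ∀ i j, |(S *ᵥ fun k => A k i) j - (Pi.single j 1 : Fin p → ℝ) i|
      ≤ C * M * r / 2 := by
    intro i j
    have e1 : (Pi.single j 1 : Fin p → ℝ) i = (V *ᵥ fun k => A k i) j := by
      have : (V *ᵥ fun k => A k i) j = (V * A) j i := rfl
      rw [this, hVA, one_apply, Pi.single_apply]
      simp only [eq_comm]
    have e2 : (S *ᵥ fun k => A k i) j - (V *ᵥ fun k => A k i) j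
        = (fun k => A k i) ⬝ᵥ (fun k => S j k - V j k) := by
      simp only [dotProduct, mulVec, mul_comm (A _ i), sub_mul, Finset.sum_sub_distrib]
    rw [e1, e2]
    refine (abs_dotProduct_le fun k => hclose j k).trans ?_
    have := mul_le_mul_of_nonneg_left (hA.sum_abs_le i) (show 0 ≤ C / 2 * r by positivity)
    linarith
  constructor
  · choose b hb using fun i => exists_isMinOn_objective hS hpos hlam (hβ i)
    obtain ⟨W, hW⟩ := exists_isSymmetrization (of fun r i => b i r)
    exact ⟨W, _, hb, hW⟩
  · rintro W ⟨B, hB, hWs, hW⟩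
    have col := fun i => column_error_le (D := 3 * C) hS hpos hq0 hq1 hA hAV hM ht0 hlam
      (by positivity) hclose (hβ i) hN1 (by rw [ht]; linarith) (hB i)
    have hmax : ∀ i j, |W i j - A i j| ≤ (3 * C + 1) * t := by
      intro i j
      rcases hW i j with ⟨-, h⟩ | ⟨-, h⟩
      · rw [h]; exact (col j).1 i
      · rw [h, ← hA.isSymm.apply i j]; exact (col i).1 j
    -- An entry of `W` may come from another column of `B`, so column sums of `B - A` do not bound
    -- those of `W - A` directly. Keeping the smaller absolute value makes `W` no larger than `B`
    -- entry by entry, which suffices where `A` is small.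
    have hWB : ∀ i j, |W i j| ≤ |B i j| := by
      intro i j
      rcases hW i j with ⟨-, h⟩ | ⟨h', h⟩
      · rw [h]
      · rwa [h]
    constructor
    · have h0 : 0 ≤ (3 * C + 1) * M ^ 2 * r := by positivity
      refine Real.iSup_le (fun i => Real.iSup_le (fun j => ?_) h0) h0
      have := hmax i j
      rw [ht] at this
      rw [Matrix.sub_apply]
      linarith
    · have h0 : 0 ≤ (15 * C + 11) * s * M ^ (2 - 2 * q) * r ^ (1 - q) := by positivity
      refine Real.iSup_le (fun j => ?_) h0
      obtain ⟨hcard, hrest⟩ := card_and_sum_le_of_absPow hq0 hq1 ht0 (hA.colSparse j)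
      set T := Finset.univ.filter fun i => t < |A i j|
      simp only [Matrix.sub_apply]
      rw [← Finset.sum_add_sum_compl T]
      have h1 : ∑ i ∈ T, |W i j - A i j| ≤ s * t ^ (-q) * ((3 * C + 1) * t) := by
        refine (Finset.sum_le_card_nsmul _ _ _ fun i _ => hmax i j).trans ?_
        rw [nsmul_eq_mul]
        exact mul_le_mul_of_nonneg_right hcard (by positivity)
      -- Off `T`, |W - A| ≤ |B| + |A| ≤ |B - A| + 2|A|. The total constant is (3C + 1) + 4(3C + 2) +
      -- 2 = 15C + 11.
      have h2 : ∑ i ∈ Tᶜ, |W i j - A i j|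
          ≤ ∑ i, |B i j - A i j| + 2 * ∑ i ∈ Tᶜ, |A i j| := by
        have h3 : ∑ i ∈ Tᶜ, |W i j - A i j|
            ≤ ∑ i ∈ Tᶜ, |B i j - A i j| + 2 * ∑ i ∈ Tᶜ, |A i j| := by
          rw [Finset.mul_sum, ← Finset.sum_add_distrib]
          refine Finset.sum_le_sum fun i _ => ?_
          have k1 := abs_sub (W i j) (A i j)
          have k2 := abs_sub_abs_le_abs_sub (B i j) (A i j)
          linarith [hWB i j]
        have h4 := Finset.sum_le_sum_of_subset_of_nonneg (Finset.subset_univ Tᶜ)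
          fun i _ _ => abs_nonneg (B i j - A i j)
        linarith
      have h5 := (col j).2
      have h6 : (15 * C + 11) * s * M ^ (2 - 2 * q) * r ^ (1 - q)
          = (15 * C + 11) * (s * t ^ (-q) * t) := by rw [hN2]; ring
      rw [h6]
      linarith

end Deterministic

/-! ### Chernoff bounds for sums of i.i.d. variables -/

section Concentration

theorem exp_le_one_add_add_sq_mul_exp_abs (x : ℝ) :
    Real.exp x ≤ 1 + x + x ^ 2 * Real.exp |x| := by
  have h := Complex.norm_exp_sub_sum_le_norm_mul_exp (x : ℂ) 2
  simp only [Finset.sum_range_succ, Finset.sum_range_zero, pow_zero, Nat.factorial, zero_add,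
    pow_one, Nat.cast_one, div_one, Complex.norm_real, Real.norm_eq_abs, sq_abs, mul_one] at h
  have h2 : Complex.exp x - (1 + x) = ((Real.exp x - (1 + x) : ℝ) : ℂ) := by push_cast; rfl
  rw [h2, Complex.norm_real, Real.norm_eq_abs] at h
  linarith [le_abs_self (Real.exp x - (1 + x))]

variable {E : Type*} [MeasurableSpace E] {ν : Measure E} [IsProbabilityMeasure ν]

theorem integrable_exp_mul_of_sq_mul_exp {g : E → ℝ} (hgm : Measurable g) (hg : Integrable g ν)
    {r : ℝ} (hr : 0 ≤ r) (hg2 : Integrable (fun x => g x ^ 2 * Real.exp (r * |g x|)) ν) :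
    Integrable (fun x => Real.exp (r * g x)) ν := by
  refine Integrable.mono' (g := fun x => 1 + r * g x + r ^ 2 * (g x ^ 2 * Real.exp (r * |g x|)))
    (((integrable_const _).add (hg.const_mul _)).add (hg2.const_mul _)) (by fun_prop)
    (ae_of_all _ fun x => ?_)
  rw [Real.norm_eq_abs, Real.abs_exp]
  have := exp_le_one_add_add_sq_mul_exp_abs (r * g x)
  rw [abs_mul, abs_of_nonneg hr] at this
  linarith

/-- Integrate the second-order Taylor bound and use 1 + y ≤ eʸ. The linear term keeps the mean, so
`g` need not be centred. -/
theorem mgf_le_of_sq_mul_exp {g : E → ℝ} (hgm : Measurable g) (hg : Integrable g ν)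
    {r v : ℝ} (hr : 0 ≤ r) (hg2 : Integrable (fun x => g x ^ 2 * Real.exp (r * |g x|)) ν)
    (hv : ∫ x, g x ^ 2 * Real.exp (r * |g x|) ∂ν ≤ v) :
    mgf g ν r ≤ Real.exp (r * ∫ x, g x ∂ν + r ^ 2 * v) := by
  have h1 : mgf g ν r
      ≤ ∫ x, (1 + r * g x + r ^ 2 * (g x ^ 2 * Real.exp (r * |g x|))) ∂ν := by
    refine integral_mono (integrable_exp_mul_of_sq_mul_exp hgm hg hr hg2)
      (((integrable_const _).add (hg.const_mul _)).add (hg2.const_mul _)) fun x => ?_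
    have := exp_le_one_add_add_sq_mul_exp_abs (r * g x)
    rw [abs_mul, abs_of_nonneg hr] at this
    simp only
    linarith
  rw [integral_add (f := fun x => 1 + r * g x) ((integrable_const _).add (hg.const_mul _))
      (hg2.const_mul _), integral_add (integrable_const _) (hg.const_mul _), integral_const_mul, integral_const_mul,
    integral_const, probReal_univ, one_smul] at h1
  have h2 := Real.add_one_le_exp (r * ∫ x, g x ∂ν + r ^ 2 * v)
  have h3 := mul_le_mul_of_nonneg_left hv (sq_nonneg r)
  linarith

variable {Ω : Type*} [MeasurableSpace Ω] {P : Measure Ω} [IsProbabilityMeasure P]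

/-- One-sided Chernoff bound, with exponential parameter `r` and deviation `C * r`. -/
theorem measure_sum_ge_le {n : ℕ} {X : Fin n → Ω → E} (hlaw : ∀ k, HasLaw (X k) ν P)
    (hind : iIndepFun X P) {g : E → ℝ} (hgm : Measurable g) (hg : Integrable g ν)
    {r v : ℝ} (hr : 0 ≤ r) (hg2 : Integrable (fun x => g x ^ 2 * Real.exp (r * |g x|)) ν)
    (hv : ∫ x, g x ^ 2 * Real.exp (r * |g x|) ∂ν ≤ v) (C : ℝ) :
    P.real {ω | n * (∫ x, g x ∂ν + C * r) ≤ ∑ k, g (X k ω)}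
      ≤ Real.exp (-(n * r ^ 2 * (C - v))) := by
  have hX : ∀ k, AEMeasurable (fun ω => g (X k ω)) P := fun k =>
    hgm.comp_aemeasurable (hlaw k).aemeasurable
  have hindg : iIndepFun (fun k ω => g (X k ω)) P :=
    hind.comp (fun _ => g) fun _ => hgm
  have hmgf : ∀ k, mgf (fun ω => g (X k ω)) P r = mgf g ν r := fun k =>
    (hlaw k).integral_comp (f := fun x => Real.exp (r * g x)) (by fun_prop)
  have hint1 : ∀ k, Integrable (fun ω => Real.exp (r * g (X k ω))) P := by
    intro k
    have h := integrable_exp_mul_of_sq_mul_exp hgm hg hr hg2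
    rw [← (hlaw k).map_eq] at h
    exact h.comp_aemeasurable (hlaw k).aemeasurable
  have hint : Integrable (fun ω => Real.exp (r * (∑ k, fun ω => g (X k ω)) ω)) P := by
    -- Without integrability the mgf would take the default value 0, yet it is a product of positive
    -- factors.
    by_contra h
    have h0 : mgf (∑ k, fun ω => g (X k ω)) P r = 0 := integral_undef h
    rw [hindg.mgf_sum₀ hX] at h0
    exact (Finset.prod_pos fun k _ => mgf_pos (hint1 k)).ne' h0
  have h := measure_ge_le_exp_mul_mgf (μ := P) (X := ∑ k, fun ω => g (X k ω))
    (n * (∫ x, g x ∂ν + C * r)) hr hint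
  rw [hindg.mgf_sum₀ hX] at h
  simp only [Finset.sum_apply, hmgf, Finset.prod_const, Finset.card_univ, Fintype.card_fin] at h
  refine h.trans ?_
  have h2 := pow_le_pow_left₀ mgf_nonneg (mgf_le_of_sq_mul_exp hgm hg hr hg2 hv) n
  refine (mul_le_mul_of_nonneg_left h2 (Real.exp_nonneg _)).trans (le_of_eq ?_)
  rw [← Real.exp_nat_mul, ← Real.exp_add]
  congr 1
  ring

/-- Two-sided version of `measure_sum_ge_le`. -/
theorem measure_abs_sum_sub_ge_le {n : ℕ} {X : Fin n → Ω → E} (hlaw : ∀ k, HasLaw (X k) ν P)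
    (hind : iIndepFun X P) {g : E → ℝ} (hgm : Measurable g) (hg : Integrable g ν)
    {r v : ℝ} (hr : 0 ≤ r) (hg2 : Integrable (fun x => g x ^ 2 * Real.exp (r * |g x|)) ν)
    (hv : ∫ x, g x ^ 2 * Real.exp (r * |g x|) ∂ν ≤ v) (C : ℝ) :
    P.real {ω | n * (C * r) ≤ |∑ k, g (X k ω) - n * ∫ x, g x ∂ν|}
      ≤ 2 * Real.exp (-(n * r ^ 2 * (C - v))) := by
  have h1 := measure_sum_ge_le hlaw hind hgm hg hr hg2 hv C
  have h2 := measure_sum_ge_le hlaw hind (g := fun x => -g x) hgm.neg hg.neg hr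
    (by simpa using hg2) (by simpa using hv) C
  refine (measureReal_mono (s₂ := {ω | n * (∫ x, g x ∂ν + C * r) ≤ ∑ k, g (X k ω)} ∪
    {ω | n * (∫ x, -g x ∂ν + C * r) ≤ ∑ k, -g (X k ω)}) fun ω hω => ?_).trans
    ((measureReal_union_le _ _).trans (by linarith))
  simp only [Set.mem_union, Set.mem_ofPred_eq, Finset.sum_neg_distrib, integral_neg] at hω ⊢
  rcases le_abs.mp hω with h | h
  · left; linarith
  · right; linarith

end Concentration

/-! ### Entrywise deviation of the sample covariance matrix -/

section Sample

variable {p n : ℕ}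

theorem popCov_apply (ν : Measure (Fin p → ℝ)) (i j : Fin p) :
    popCov ν i j = ∫ x, (x i - mean ν i) * (x j - mean ν j) ∂ν := rfl

/-- The sample covariance is shift invariant. -/
theorem sampleCov_eq_of_shift (hn : 1 ≤ n) (x : Fin n → Fin p → ℝ) (m : Fin p → ℝ)
    (i j : Fin p) :
    sampleCov x i j = (∑ k, (x k i - m i) * (x k j - m j)) / n
      - (∑ k, (x k i - m i)) / n * ((∑ k, (x k j - m j)) / n) := by
  have hn0 : (n : ℝ) ≠ 0 := by positivity
  have e : ∀ i, ∑ k, (x k i - m i) = n * (sampleMean x i - m i) := by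
    intro i
    simp only [Finset.sum_sub_distrib, Finset.sum_const, Finset.card_univ, Fintype.card_fin,
      nsmul_eq_mul, sampleMean]
    field_simp
  have e2 : ∑ k, (x k i - sampleMean x i) * (x k j - sampleMean x j)
      = ∑ k, (x k i - m i) * (x k j - m j)
        - (sampleMean x i - m i) * ∑ k, (x k j - m j)
        - (sampleMean x j - m j) * ∑ k, (x k i - m i)
        + n * ((sampleMean x i - m i) * (sampleMean x j - m j)) := by
    rw [Finset.mul_sum, Finset.mul_sum, ← Finset.sum_sub_distrib, ← Finset.sum_sub_distrib]
    have : (n : ℝ) * ((sampleMean x i - m i) * (sampleMean x j - m j))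
      = ∑ _k : Fin n, (sampleMean x i - m i) * (sampleMean x j - m j) := by simp
    rw [this, ← Finset.sum_add_distrib]
    refine Finset.sum_congr rfl fun k _ => by ring
  simp only [sampleCov, Matrix.of_apply, e2, e]
  field_simp
  ring

/-- Estimating the mean costs a product of two averages, at most ε² ≤ ε. -/
theorem abs_sampleCov_sub_le (hn : 1 ≤ n) {x : Fin n → Fin p → ℝ} {m : Fin p → ℝ} {i j : Fin p}
    {σ ε : ℝ} (hε1 : ε ≤ 1)
    (h2 : |(∑ k, (x k i - m i) * (x k j - m j)) / n - σ| ≤ ε)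
    (h1i : |(∑ k, (x k i - m i)) / n| ≤ ε) (h1j : |(∑ k, (x k j - m j)) / n| ≤ ε) :
    |sampleCov x i j - σ| ≤ 2 * ε := by
  rw [sampleCov_eq_of_shift hn x m]
  have h3 := mul_le_mul h1i h1j (abs_nonneg _) ((abs_nonneg _).trans h1i)
  rw [← abs_mul] at h3
  have h4 : ε * ε ≤ ε := mul_le_of_le_one_right ((abs_nonneg _).trans h2) hε1
  have h5 := abs_sub ((∑ k, (x k i - m i) * (x k j - m j)) / n - σ)
    ((∑ k, (x k i - m i)) / n * ((∑ k, (x k j - m j)) / n))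
  rw [sub_right_comm]
  linarith

theorem abs_average_sub_le {a b c c' r s t : ℝ} (hn : 1 ≤ n) (h : ¬ n * (c * r) ≤ |s - n * a|)
    (hst : s = t) (hab : |a - b| ≤ c' * r) : |t / n - b| ≤ (c + c') * r := by
  have hn0 : (0 : ℝ) < n := by positivity
  have h1 : |t / n - a| ≤ c * r := by
    have : t / n - a = (s - n * a) / n := by rw [hst]; field_simp
    rw [this, abs_div, abs_of_pos hn0, div_le_iff₀ hn0]
    linarith
  have h2 := abs_add_le (t / n - a) (a - b)
  rw [sub_add_sub_cancel] at h2
  linarith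

/-- Entrywise deviation of the sample covariance matrix, via a truncation `φ` of the centred
coordinates. -/
theorem measure_sampleCov_deviation_le {Ω : Type*} [MeasurableSpace Ω] {P : Measure Ω}
    [IsProbabilityMeasure P] {ν : Measure (Fin p → ℝ)} [IsProbabilityMeasure ν]
    {X : Fin n → Ω → Fin p → ℝ} (hX : IsIIDSample P ν X) (hn : 1 ≤ n) {φ : ℝ → ℝ}
    (hφ : Measurable φ) {r v C c b : ℝ} (hr : 0 ≤ r)
    (hint1 : ∀ i, Integrable (fun x => φ (x i - mean ν i)) ν)
    (hint2 : ∀ i j, Integrable (fun x => φ (x i - mean ν i) * φ (x j - mean ν j)) ν)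
    (hexp1 : ∀ i, Integrable (fun x => φ (x i - mean ν i) ^ 2
      * Real.exp (r * |φ (x i - mean ν i)|)) ν)
    (hexp2 : ∀ i j, Integrable (fun x => (φ (x i - mean ν i) * φ (x j - mean ν j)) ^ 2
      * Real.exp (r * |φ (x i - mean ν i) * φ (x j - mean ν j)|)) ν)
    (hv1 : ∀ i, ∫ x, φ (x i - mean ν i) ^ 2 * Real.exp (r * |φ (x i - mean ν i)|) ∂ν ≤ v)
    (hv2 : ∀ i j, ∫ x, (φ (x i - mean ν i) * φ (x j - mean ν j)) ^ 2
      * Real.exp (r * |φ (x i - mean ν i) * φ (x j - mean ν j)|) ∂ν ≤ v)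
    (hbias1 : ∀ i, |∫ x, φ (x i - mean ν i) ∂ν| ≤ c * r)
    (hbias2 : ∀ i j, |∫ x, φ (x i - mean ν i) * φ (x j - mean ν j) ∂ν - popCov ν i j| ≤ c * r)
    (hsmall : (C + c) * r ≤ 1)
    (hbad : ∀ i, ν.real {x | φ (x i - mean ν i) ≠ x i - mean ν i} ≤ b) :
    P.real {ω | ¬ ∀ i j, |sampleCov (fun k => X k ω) i j - popCov ν i j| ≤ 2 * ((C + c) * r)}
      ≤ 4 * p ^ 2 * Real.exp (-(n * r ^ 2 * (C - v))) + n * p * b := by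
  set m := mean ν with hm
  set e := Real.exp (-(n * r ^ 2 * (C - v))) with he
  let A : Fin p → Fin p → Set Ω := fun i j => {ω | n * (C * r)
    ≤ |∑ k, φ (X k ω i - m i) * φ (X k ω j - m j)
      - n * ∫ x, φ (x i - m i) * φ (x j - m j) ∂ν|}
  let B : Fin p → Set Ω := fun i => {ω | n * (C * r)
    ≤ |∑ k, φ (X k ω i - m i) - n * ∫ x, φ (x i - m i) ∂ν|}
  let D : Fin n → Fin p → Set Ω := fun k i => {ω | φ (X k ω i - m i) ≠ X k ω i - m i}
  have hA : ∀ i j, P.real (A i j) ≤ 2 * e := fun i j =>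
    measure_abs_sum_sub_ge_le hX.law hX.indep (g := fun x => φ (x i - m i) * φ (x j - m j))
      (by fun_prop) (hint2 i j) hr (hexp2 i j) (hv2 i j) C
  have hB : ∀ i, P.real (B i) ≤ 2 * e := fun i =>
    measure_abs_sum_sub_ge_le hX.law hX.indep (g := fun x => φ (x i - m i))
      (by fun_prop) (hint1 i) hr (hexp1 i) (hv1 i) C
  have hD : ∀ k i, P.real (D k i) ≤ b := fun k i => by
    have hms : MeasurableSet {x : Fin p → ℝ | φ (x i - m i) ≠ x i - m i} :=
      (measurableSet_eq_fun (by fun_prop) (by fun_prop)).compl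
    exact ((hX.law k).measureReal_eq hms).trans_le (hbad i)
  have hsub : {ω | ¬ ∀ i j, |sampleCov (fun k => X k ω) i j - popCov ν i j|
      ≤ 2 * ((C + c) * r)} ⊆ ((⋃ i, ⋃ j, A i j) ∪ ⋃ i, B i) ∪ ⋃ k, ⋃ i, D k i := by
    intro ω
    contrapose
    intro hω
    simp only [Set.mem_union, Set.mem_iUnion, not_or, not_exists] at hω
    obtain ⟨⟨hωA, hωB⟩, hωD⟩ := hω
    -- Outside the events `D`, truncation changes no observation, so the bounds for truncated sums
    -- apply to the actual ones.
    have hφeq : ∀ k i, φ (X k ω i - m i) = X k ω i - m i := fun k i => not_not.mp (hωD k i)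
    rw [Set.mem_ofPred_eq, not_not]
    intro i j
    have h1 : ∀ i, |(∑ k, (X k ω i - m i)) / n| ≤ (C + c) * r := by
      intro i
      have := abs_average_sub_le (b := 0) hn (hωB i) rfl (by rw [sub_zero]; exact hbias1 i)
      simpa only [hφeq, sub_zero] using this
    refine abs_sampleCov_sub_le hn hsmall ?_ (h1 i) (h1 j)
    have := abs_average_sub_le hn (hωA i j) rfl (hbias2 i j)
    simpa only [hφeq] using this
  refine (measureReal_mono hsub).trans ((measureReal_union_le _ _).trans (add_le_add
    ((measureReal_union_le _ _).trans ?_) ?_))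
  · have h1 : P.real (⋃ i, ⋃ j, A i j) ≤ p ^ 2 * (2 * e) := by
      refine (measureReal_iUnion_fintype_le _).trans ((Finset.sum_le_card_nsmul _ _
        (p * (2 * e)) fun i _ => ?_).trans (le_of_eq ?_))
      · refine (measureReal_iUnion_fintype_le _).trans ((Finset.sum_le_card_nsmul _ _
          _ fun j _ => hA i j).trans (le_of_eq ?_))
        simp
      · simp; ring
    have h2 : P.real (⋃ i, B i) ≤ p * (2 * e) := by
      refine (measureReal_iUnion_fintype_le _).trans ((Finset.sum_le_card_nsmul _ _
        _ fun i _ => hB i).trans (le_of_eq ?_))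
      simp
    -- The `p` first-order events are absorbed into the `p ^ 2` second-order ones, whence the factor
    -- 4.
    have h3 : (p : ℝ) ≤ p ^ 2 := by exact_mod_cast Nat.le_self_pow two_ne_zero p
    have h4 := mul_le_mul_of_nonneg_right h3 (by positivity : 0 ≤ 2 * e)
    linarith
  · refine (measureReal_iUnion_fintype_le _).trans ((Finset.sum_le_card_nsmul _ _
      (p * b) fun k _ => ?_).trans (le_of_eq ?_))
    · refine (measureReal_iUnion_fintype_le _).trans ((Finset.sum_le_card_nsmul _ _
        _ fun j _ => hD k j).trans (le_of_eq ?_))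
      simp
    · simp; ring

end Sample

/-! ### Exponential-type tails -/

section ExpTails

/-- Half of the exponent η u² absorbs u²; the other half absorbs r|u|, since |u| ≤ 1 + u². -/
theorem sq_mul_exp_le_of_exp_sq {η r : ℝ} (hη : 0 < η) (hrη : r ≤ η / 2) (u : ℝ) :
    u ^ 2 * Real.exp (r * |u|) ≤ 2 / η * Real.exp (η / 2) * Real.exp (η * u ^ 2) := by
  have h1 : u ^ 2 ≤ 2 / η * Real.exp (η / 2 * u ^ 2) := by
    have := Real.add_one_le_exp (η / 2 * u ^ 2)
    have h2 := mul_le_mul_of_nonneg_left this (show 0 ≤ 2 / η by positivity)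
    have h3 : 2 / η * (η / 2 * u ^ 2 + 1) = u ^ 2 + 2 / η := by field_simp
    have : 0 < 2 / η := by positivity
    linarith
  have h2 : r * |u| ≤ η / 2 + η / 2 * u ^ 2 := by
    have h3 := mul_le_mul_of_nonneg_right hrη (abs_nonneg u)
    have h4 : |u| ≤ 1 + u ^ 2 := by rw [← sq_abs]; nlinarith [sq_nonneg (|u| - 1)]
    have h5 := mul_le_mul_of_nonneg_left h4 (half_pos hη).le
    linarith
  calc u ^ 2 * Real.exp (r * |u|)
      ≤ (2 / η * Real.exp (η / 2 * u ^ 2)) * Real.exp (η / 2 + η / 2 * u ^ 2) := by gcongr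
    _ = _ := by
      rw [mul_assoc, mul_assoc, ← Real.exp_add, ← Real.exp_add]
      ring_nf

theorem abs_mul_le_sq_add_sq (u w : ℝ) : |u * w| ≤ (u ^ 2 + w ^ 2) / 2 := by
  rw [abs_mul, ← sq_abs u, ← sq_abs w]
  nlinarith [sq_nonneg (|u| - |w|)]

theorem exp_abs_mul_le {η : ℝ} (hη : 0 < η) (u w : ℝ) :
    Real.exp (η * |u * w|) ≤ Real.exp (η * u ^ 2) + Real.exp (η * w ^ 2) := by
  have h : |u * w| ≤ max (u ^ 2) (w ^ 2) := by
    have := abs_mul_le_sq_add_sq u w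
    have h1 := le_max_left (u ^ 2) (w ^ 2)
    have h2 := le_max_right (u ^ 2) (w ^ 2)
    linarith
  rcases le_max_iff.mp h with h | h
  · have := Real.exp_le_exp.mpr (mul_le_mul_of_nonneg_left h hη.le)
    linarith [Real.exp_pos (η * w ^ 2)]
  · have := Real.exp_le_exp.mpr (mul_le_mul_of_nonneg_left h hη.le)
    linarith [Real.exp_pos (η * u ^ 2)]

/-- Half of the exponent η|uw| absorbs the square through x²/2 ≤ eˣ and the other half absorbs
r|uw|; `exp_abs_mul_le` then separates the two coordinates. -/
theorem mul_sq_mul_exp_le_of_exp_sq {η r : ℝ} (hη : 0 < η) (hrη : r ≤ η / 2) (u w : ℝ) :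
    (u * w) ^ 2 * Real.exp (r * |u * w|)
      ≤ 8 / η ^ 2 * (Real.exp (η * u ^ 2) + Real.exp (η * w ^ 2)) := by
  have h1 : (u * w) ^ 2 ≤ 8 / η ^ 2 * Real.exp (η / 2 * |u * w|) := by
    have h := Real.quadratic_le_exp_of_nonneg (show 0 ≤ η / 2 * |u * w| by positivity)
    have h0 : 0 ≤ η / 2 * |u * w| := by positivity
    have h2 : (η / 2 * |u * w|) ^ 2 ≤ 2 * Real.exp (η / 2 * |u * w|) := by linarith
    rw [mul_pow, sq_abs] at h2
    rw [div_mul_eq_mul_div, le_div_iff₀ (by positivity)]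
    linarith
  refine le_trans ?_ (mul_le_mul_of_nonneg_left (exp_abs_mul_le hη u w) (by positivity))
  calc (u * w) ^ 2 * Real.exp (r * |u * w|)
      ≤ (8 / η ^ 2 * Real.exp (η / 2 * |u * w|)) * Real.exp (η / 2 * |u * w|) := by gcongr
    _ = _ := by
      rw [mul_assoc, ← Real.exp_add]
      ring_nf

variable {p n : ℕ}

/-- Entrywise deviation of the sample covariance matrix under exponential-type tails. -/
theorem measure_sampleCov_deviation_le_of_exp {Ω : Type*} [MeasurableSpace Ω] {P : Measure Ω}
    [IsProbabilityMeasure P] {ν : Measure (Fin p → ℝ)} [IsProbabilityMeasure ν]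
    {X : Fin n → Ω → Fin p → ℝ} (hX : IsIIDSample P ν X) (hn : 1 ≤ n) {η K r C : ℝ}
    (hη : 0 < η) (hK : 0 < K)
    (hint : ∀ i, Integrable (fun x => Real.exp (η * (x i - mean ν i) ^ 2)) ν)
    (hmom : ∀ i, ∫ x, Real.exp (η * (x i - mean ν i) ^ 2) ∂ν ≤ K)
    (hr : 0 ≤ r) (hrη : r ≤ η / 2) (hsmall : C * r ≤ 1) :
    P.real {ω | ¬ ∀ i j, |sampleCov (fun k => X k ω) i j - popCov ν i j| ≤ 2 * (C * r)}
      ≤ 4 * p ^ 2 * Real.exp (-(n * r ^ 2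
        * (C - (2 / η * Real.exp (η / 2) + 16 / η ^ 2) * K))) := by
  have e2 : ∀ i j, Integrable (fun x => Real.exp (η * (x i - mean ν i) ^ 2)
      + Real.exp (η * (x j - mean ν j) ^ 2)) ν := fun i j => (hint i).add (hint j)
  have hsq : ∀ u : ℝ, η * u ^ 2 ≤ Real.exp (η * u ^ 2) := fun u => by
    linarith [Real.add_one_le_exp (η * u ^ 2)]
  have hint1 : ∀ i, Integrable (fun x => x i - mean ν i) ν := fun i => by
    refine Integrable.mono' (((integrable_const 1).add ((hint i).const_mul (1 / η)))) (Measurable.aestronglyMeasurable (by fun_prop))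
      (ae_of_all _ fun x => ?_)
    have h1 := mul_le_mul_of_nonneg_left (hsq (x i - mean ν i)) (show 0 ≤ 1 / η by positivity)
    have h2 : 1 / η * (η * (x i - mean ν i) ^ 2) = (x i - mean ν i) ^ 2 := by field_simp
    rw [Real.norm_eq_abs]
    simp only [Pi.add_apply]
    nlinarith [sq_abs (x i - mean ν i), sq_nonneg (|x i - mean ν i| - 1)]
  have hint2 : ∀ i j, Integrable (fun x => (x i - mean ν i) * (x j - mean ν j)) ν := fun i j => by
    refine Integrable.mono' ((e2 i j).const_mul (1 / η)) (Measurable.aestronglyMeasurable (by fun_prop)) (ae_of_all _ fun x => ?_)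
    have h1 := Real.add_one_le_exp (η * |(x i - mean ν i) * (x j - mean ν j)|)
    have h2 := exp_abs_mul_le hη (x i - mean ν i) (x j - mean ν j)
    rw [Real.norm_eq_abs, div_mul_eq_mul_div, one_mul, le_div_iff₀ hη]
    linarith
  have hexp1 : ∀ i, Integrable (fun x => (x i - mean ν i) ^ 2
      * Real.exp (r * |x i - mean ν i|)) ν := fun i => by
    refine Integrable.mono' ((hint i).const_mul (2 / η * Real.exp (η / 2)))
      (Measurable.aestronglyMeasurable (by fun_prop)) (ae_of_all _ fun x => ?_)
    rw [Real.norm_eq_abs, abs_of_nonneg (by positivity)]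
    exact sq_mul_exp_le_of_exp_sq hη hrη _
  have hexp2 : ∀ i j, Integrable (fun x => ((x i - mean ν i) * (x j - mean ν j)) ^ 2
      * Real.exp (r * |(x i - mean ν i) * (x j - mean ν j)|)) ν := fun i j => by
    refine Integrable.mono' ((e2 i j).const_mul (8 / η ^ 2)) (Measurable.aestronglyMeasurable (by fun_prop)) (ae_of_all _ fun x => ?_)
    rw [Real.norm_eq_abs, abs_of_nonneg (by positivity)]
    exact mul_sq_mul_exp_le_of_exp_sq hη hrη _ _
  have hmean : ∀ i, ∫ x, (x i - mean ν i) ∂ν = 0 := fun i => by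
    have : Integrable (fun x : Fin p → ℝ => x i) ν := by
      have h := (hint1 i).add (integrable_const (mean ν i))
      exact h.congr (ae_of_all _ fun x => sub_add_cancel (x i) (mean ν i))
    rw [integral_sub this (integrable_const _), integral_const, probReal_univ, one_smul]
    exact sub_self _
  -- No truncation is needed, so there is neither bias nor a bad event. The two summands of `v`
  -- serve the coordinates and their products respectively.
  have h := measure_sampleCov_deviation_le hX hn (φ := id) measurable_id (r := r)
    (v := (2 / η * Real.exp (η / 2) + 16 / η ^ 2) * K) (C := C) (c := 0) (b := 0) hr hint1 hint2
    hexp1 hexp2 (fun i => ?_) (fun i j => ?_) (fun i => ?_) (fun i j => ?_) (by simpa using hsmall)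
    (fun i => by simp)
  · simpa using h
  · have h1 := integral_mono (hexp1 i) ((hint i).const_mul _)
      fun x => sq_mul_exp_le_of_exp_sq hη hrη (x i - mean ν i)
    rw [integral_const_mul] at h1
    have h2 := mul_le_mul_of_nonneg_left (hmom i)
      (show 0 ≤ 2 / η * Real.exp (η / 2) by positivity)
    have h3 : 0 ≤ 16 / η ^ 2 * K := by positivity
    simp only [id]
    linarith
  · have h1 := integral_mono (hexp2 i j) ((e2 i j).const_mul _)
      fun x => mul_sq_mul_exp_le_of_exp_sq hη hrη (x i - mean ν i) (x j - mean ν j)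
    rw [integral_const_mul, integral_add (hint i) (hint j)] at h1
    have h2 := mul_le_mul_of_nonneg_left (add_le_add (hmom i) (hmom j))
      (show 0 ≤ 8 / η ^ 2 by positivity)
    have h3 : 0 ≤ 2 / η * Real.exp (η / 2) * K := by positivity
    have h4 : 8 / η ^ 2 * (K + K) = 16 / η ^ 2 * K := by ring
    simp only [id]
    linarith
  · simp [hmean]
  · simp [popCov_apply]

end ExpTails

/-! ### Polynomial-type tails via truncation -/

section PolyTails

/-- Hard truncation at level `B`. -/
noncomputable def truncate (B u : ℝ) : ℝ := if |u| ≤ B then u else 0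

@[fun_prop]
theorem measurable_truncate (B : ℝ) : Measurable (truncate B) :=
  Measurable.ite (measurableSet_le (by fun_prop) (by fun_prop)) measurable_id measurable_const

theorem abs_truncate_le_abs (B u : ℝ) : |truncate B u| ≤ |u| := by
  unfold truncate; split_ifs <;> simp

theorem abs_truncate_le {B : ℝ} (hB : 0 ≤ B) (u : ℝ) : |truncate B u| ≤ B := by
  unfold truncate; split_ifs <;> simpa

theorem abs_truncate_sub_le {B : ℝ} (hB : 1 ≤ B) (u : ℝ) :
    |truncate B u - u| ≤ (B ^ 2)⁻¹ * u ^ 4 := by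
  unfold truncate
  split_ifs with h
  · rw [sub_self, abs_zero]; positivity
  · push Not at h
    rw [zero_sub, abs_neg, inv_mul_eq_div, le_div_iff₀ (by positivity)]
    have h1 : B ^ 2 ≤ |u| ^ 2 := by gcongr
    have h2 : 1 ≤ |u| := by linarith
    have h3 : |u| ^ 3 ≤ |u| ^ 4 := pow_le_pow_right₀ h2 (by norm_num)
    have h4 := mul_le_mul_of_nonneg_left h1 (abs_nonneg u)
    have h5 : |u| ^ 4 = u ^ 4 := by rw [show 4 = 2 * 2 from rfl, pow_mul, sq_abs, pow_mul]
    nlinarith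

theorem sq_le_of_lt_abs {B u : ℝ} (hB : 1 ≤ B) (h : B < |u|) : u ^ 2 ≤ (B ^ 2)⁻¹ * u ^ 4 := by
  rw [inv_mul_eq_div, le_div_iff₀ (by positivity)]
  have h1 : B ^ 2 ≤ u ^ 2 := by rw [← sq_abs u]; gcongr
  nlinarith [sq_nonneg u]

/-- The two sides differ only if the larger of |u|, |w| exceeds `B`; then |uw| is at most its
square, and fourth moments gain the factor B⁻². -/
theorem abs_truncate_mul_sub_le {B : ℝ} (hB : 1 ≤ B) (u w : ℝ) :
    |truncate B u * truncate B w - u * w| ≤ (B ^ 2)⁻¹ * (u ^ 4 + w ^ 4) := by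
  by_cases hu : |u| ≤ B
  · by_cases hw : |w| ≤ B
    · simp only [truncate, if_pos hu, if_pos hw, sub_self, abs_zero]; positivity
    · have h1 : |u * w| ≤ w ^ 2 := by
        rw [abs_mul, ← sq_abs w, sq]
        exact mul_le_mul_of_nonneg_right (hu.trans (not_le.mp hw).le) (abs_nonneg _)
      have h2 := sq_le_of_lt_abs hB (not_le.mp hw)
      have h3 : 0 ≤ (B ^ 2)⁻¹ * u ^ 4 := by positivity
      simp only [truncate, if_neg hw, mul_zero, zero_sub, abs_neg]
      linarith
  · simp only [truncate, if_neg hu, zero_mul, zero_sub, abs_neg]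
    have h2 := sq_le_of_lt_abs hB (not_le.mp hu)
    have h3 : 0 ≤ (B ^ 2)⁻¹ * u ^ 4 := by positivity
    have h4 : 0 ≤ (B ^ 2)⁻¹ * w ^ 4 := by positivity
    rcases le_total |w| |u| with h | h
    · have h1 : |u * w| ≤ u ^ 2 := by
        rw [abs_mul, ← sq_abs u, sq]
        exact mul_le_mul_of_nonneg_left h (abs_nonneg _)
      linarith
    · have h1 : |u * w| ≤ w ^ 2 := by
        rw [abs_mul, ← sq_abs w, sq]
        exact mul_le_mul_of_nonneg_right h (abs_nonneg _)
      have h5 := sq_le_of_lt_abs hB ((not_le.mp hu).trans_le h)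
      linarith

theorem pow_le_one_add_rpow {α : ℝ} (k : ℕ) (hk : (k : ℝ) ≤ α) (u : ℝ) :
    |u| ^ k ≤ 1 + |u| ^ α := by
  have h0 : 0 ≤ |u| ^ α := by positivity
  rcases le_total |u| 1 with h | h
  · linarith [pow_le_one₀ (n := k) (abs_nonneg u) h]
  · rw [← Real.rpow_natCast]
    linarith [Real.rpow_le_rpow_of_exponent_le h hk]

variable {p n : ℕ}

/-- Entrywise deviation of the sample covariance matrix under polynomial-type tails. -/
theorem measure_sampleCov_deviation_le_of_poly {Ω : Type*} [MeasurableSpace Ω] {P : Measure Ω}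
    [IsProbabilityMeasure P] {ν : Measure (Fin p → ℝ)} [IsProbabilityMeasure ν]
    {X : Fin n → Ω → Fin p → ℝ} (hX : IsIIDSample P ν X) (hn : 1 ≤ n) {α K r C : ℝ}
    (hα : 4 ≤ α) (hK : 0 < K) (hint : ∀ i, Integrable (fun x => |x i - mean ν i| ^ α) ν)
    (hmom : ∀ i, ∫ x, |x i - mean ν i| ^ α ∂ν ≤ K)
    (hr : 0 < r) (hr1 : r ≤ 1) (hsmall : (C + 2 * (1 + K)) * r ≤ 1) :
    P.real {ω | ¬ ∀ i j, |sampleCov (fun k => X k ω) i j - popCov ν i j|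
        ≤ 2 * ((C + 2 * (1 + K)) * r)}
      ≤ 4 * p ^ 2 * Real.exp (-(n * r ^ 2 * (C - 3 * (1 + K))))
        + n * p * (K * r ^ (α / 2)) := by
  -- The level with r B² = 1: truncated products y satisfy r|y| ≤ 1, so e^(r|y|) ≤ 3; the bias has
  -- order B⁻² = r; and Markov's inequality gives tail probability K B^(-α) = K r^(α/2).
  set B := √r⁻¹ with hB
  have hB2 : (B ^ 2)⁻¹ = r := by rw [hB, Real.sq_sqrt (by positivity), inv_inv]
  have hB1 : 1 ≤ B := by rw [hB, Real.one_le_sqrt]; exact (one_le_inv₀ hr).mpr hr1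
  have hrB2 : r * B ^ 2 = 1 := by rw [← hB2]; field_simp
  have hφm := measurable_truncate B
  have hpow : ∀ k : ℕ, (k : ℝ) ≤ α → ∀ i, Integrable (fun x => |x i - mean ν i| ^ k) ν ∧
      ∫ x, |x i - mean ν i| ^ k ∂ν ≤ 1 + K := by
    intro k hk i
    have h1 : Integrable (fun x => 1 + |x i - mean ν i| ^ α) ν := (integrable_const _).add (hint i)
    have h2 : Integrable (fun x => |x i - mean ν i| ^ k) ν := by
      refine Integrable.mono' h1 (Measurable.aestronglyMeasurable (by fun_prop)) (ae_of_all _ fun x => ?_)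
      rw [Real.norm_eq_abs, abs_of_nonneg (by positivity)]
      exact pow_le_one_add_rpow k hk _
    refine ⟨h2, (integral_mono h2 h1 fun x => pow_le_one_add_rpow k hk _).trans ?_⟩
    rw [integral_add (integrable_const _) (hint i), integral_const, probReal_univ, one_smul]
    linarith [hmom i]
  have hp4 : ∀ i, Integrable (fun x => (x i - mean ν i) ^ 4) ν ∧
      ∫ x, (x i - mean ν i) ^ 4 ∂ν ≤ 1 + K := fun i => by
    simpa only [(show Even 4 by decide).pow_abs] using hpow 4 (by simpa using hα) i
  have hp2 : ∀ i, Integrable (fun x => (x i - mean ν i) ^ 2) ν ∧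
      ∫ x, (x i - mean ν i) ^ 2 ∂ν ≤ 1 + K := fun i => by
    simpa only [sq_abs] using hpow 2 (by push_cast; linarith) i
  have hp1 : ∀ i, Integrable (fun x => x i - mean ν i) ν := fun i => by
    have := (hpow 1 (by push_cast; linarith) i).1
    simp only [pow_one] at this
    exact (integrable_norm_iff (Measurable.aestronglyMeasurable (by fun_prop))).mp this
  have hmean : ∀ i, ∫ x, (x i - mean ν i) ∂ν = 0 := fun i => by
    have : Integrable (fun x : Fin p → ℝ => x i) ν := by
      have h := (hp1 i).add (integrable_const (mean ν i))
      exact h.congr (ae_of_all _ fun x => sub_add_cancel (x i) (mean ν i))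
    rw [integral_sub this (integrable_const _), integral_const, probReal_univ, one_smul]
    exact sub_self _
  have hUU : ∀ i j, Integrable (fun x => (x i - mean ν i) * (x j - mean ν j)) ν := fun i j => by
    refine Integrable.mono' (((hp2 i).1.add (hp2 j).1).div_const 2) (Measurable.aestronglyMeasurable (by fun_prop))
      (ae_of_all _ fun x => ?_)
    exact abs_mul_le_sq_add_sq _ _
  have b2 : ∀ u w : ℝ, |truncate B u * truncate B w| ≤ B ^ 2 := fun u w => by
    rw [abs_mul, sq]
    exact mul_le_mul (abs_truncate_le (by linarith) _) (abs_truncate_le (by linarith) _)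
      (abs_nonneg _) (by linarith)
  have hexp : ∀ y : ℝ, |y| ≤ B ^ 2 → Real.exp (r * |y|) ≤ 3 := fun y hy => by
    have h1 := mul_le_mul_of_nonneg_left hy hr.le
    rw [hrB2] at h1
    linarith [Real.exp_le_exp.mpr h1, Real.exp_one_lt_d9]
  have q1 : ∀ u : ℝ, truncate B u ^ 2 * Real.exp (r * |truncate B u|) ≤ 3 * u ^ 2 := fun u => by
    have h1 : |truncate B u| ≤ B ^ 2 :=
      (abs_truncate_le (by linarith) _).trans (by nlinarith)
    have h2 : truncate B u ^ 2 ≤ u ^ 2 := sq_le_sq.mpr (abs_truncate_le_abs B u)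
    rw [mul_comm 3]
    exact mul_le_mul h2 (hexp _ h1) (Real.exp_nonneg _) (sq_nonneg _)
  have q2 : ∀ u w : ℝ, (truncate B u * truncate B w) ^ 2
      * Real.exp (r * |truncate B u * truncate B w|) ≤ 3 / 2 * (u ^ 4 + w ^ 4) := fun u w => by
    have h2 : (truncate B u * truncate B w) ^ 2 ≤ u ^ 2 * w ^ 2 := by
      rw [mul_pow]
      exact mul_le_mul (sq_le_sq.mpr (abs_truncate_le_abs B u))
        (sq_le_sq.mpr (abs_truncate_le_abs B w)) (sq_nonneg _) (sq_nonneg _)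
    have h3 : u ^ 2 * w ^ 2 ≤ (u ^ 4 + w ^ 4) / 2 := by nlinarith [sq_nonneg (u ^ 2 - w ^ 2)]
    have h4 := mul_le_mul (h2.trans h3) (hexp _ (b2 u w)) (Real.exp_nonneg _) (by positivity)
    linarith
  have hint1 : ∀ i, Integrable (fun x => truncate B (x i - mean ν i)) ν := fun i =>
    Integrable.mono (hp1 i) (Measurable.aestronglyMeasurable (by fun_prop)) (ae_of_all _ fun x => abs_truncate_le_abs _ _)
  have hint2 : ∀ i j, Integrable (fun x => truncate B (x i - mean ν i)
      * truncate B (x j - mean ν j)) ν := fun i j =>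
    Integrable.mono' (integrable_const (B ^ 2)) (Measurable.aestronglyMeasurable (by fun_prop)) (ae_of_all _ fun x => b2 _ _)
  have hexp1 : ∀ i, Integrable (fun x => truncate B (x i - mean ν i) ^ 2
      * Real.exp (r * |truncate B (x i - mean ν i)|)) ν := fun i => by
    refine Integrable.mono' ((hp2 i).1.const_mul 3) (Measurable.aestronglyMeasurable (by fun_prop)) (ae_of_all _ fun x => ?_)
    rw [Real.norm_eq_abs, abs_of_nonneg (by positivity)]
    exact q1 _
  have h44 : ∀ i j, Integrable (fun x => (x i - mean ν i) ^ 4 + (x j - mean ν j) ^ 4) ν :=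
    fun i j => (hp4 i).1.add (hp4 j).1
  have i44 : ∀ i j, ∫ x, ((x i - mean ν i) ^ 4 + (x j - mean ν j) ^ 4) ∂ν ≤ 2 * (1 + K) :=
    fun i j => by
      rw [integral_add (hp4 i).1 (hp4 j).1]
      linarith [(hp4 i).2, (hp4 j).2]
  have hexp2 : ∀ i j, Integrable (fun x => (truncate B (x i - mean ν i)
      * truncate B (x j - mean ν j)) ^ 2 * Real.exp (r * |truncate B (x i - mean ν i)
      * truncate B (x j - mean ν j)|)) ν := fun i j => by
    refine Integrable.mono' ((h44 i j).const_mul (3 / 2)) (Measurable.aestronglyMeasurable (by fun_prop)) (ae_of_all _ fun x => ?_)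
    rw [Real.norm_eq_abs, abs_of_nonneg (by positivity)]
    exact q2 _ _
  refine measure_sampleCov_deviation_le hX hn hφm hr.le hint1 hint2 hexp1 hexp2 (fun i => ?_)
    (fun i j => ?_) (fun i => ?_) (fun i j => ?_) hsmall (fun i => ?_)
  · have h1 := integral_mono (hexp1 i) ((hp2 i).1.const_mul 3) fun x => q1 _
    rw [integral_const_mul] at h1
    linarith [(hp2 i).2]
  · have h1 := integral_mono (hexp2 i j) ((h44 i j).const_mul (3 / 2)) fun x => q2 _ _
    rw [integral_const_mul] at h1
    linarith [i44 i j]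
  · have h1 := norm_integral_le_of_norm_le ((hp4 i).1.const_mul (B ^ 2)⁻¹)
      (f := fun x => truncate B (x i - mean ν i) - (x i - mean ν i))
      (ae_of_all _ fun x => abs_truncate_sub_le hB1 _)
    rw [integral_sub (hint1 i) (hp1 i), hmean, sub_zero, integral_const_mul, hB2,
      Real.norm_eq_abs] at h1
    have h2 := mul_le_mul_of_nonneg_left (hp4 i).2 hr.le
    nlinarith
  · have h1 := norm_integral_le_of_norm_le ((h44 i j).const_mul (B ^ 2)⁻¹)
      (f := fun x => truncate B (x i - mean ν i) * truncate B (x j - mean ν j)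
        - (x i - mean ν i) * (x j - mean ν j))
      (ae_of_all _ fun x => abs_truncate_mul_sub_le hB1 _ _)
    rw [integral_sub (hint2 i j) (hUU i j), integral_const_mul, hB2, Real.norm_eq_abs] at h1
    have h2 := mul_le_mul_of_nonneg_left (i44 i j) hr.le
    rw [popCov_apply]
    linarith
  · have h1 := mul_meas_ge_le_integral_of_nonneg (ae_of_all _ fun x => by positivity) (hint i)
      (B ^ α)
    have hBα : (B ^ α)⁻¹ = r ^ (α / 2) := by
      rw [hB, Real.sqrt_eq_rpow, ← Real.rpow_mul (by positivity), Real.inv_rpow hr.le, inv_inv]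
      congr 1; ring
    have hBpos : 0 < B ^ α := by positivity
    rw [← hBα, ← div_eq_mul_inv, le_div_iff₀ hBpos, mul_comm]
    refine le_trans (mul_le_mul_of_nonneg_left (measureReal_mono fun x hx => ?_) hBpos.le)
      (h1.trans (hmom i))
    simp only [Set.mem_ofPred_eq, truncate] at hx ⊢
    split_ifs at hx with h
    · exact absurd rfl hx
    · exact Real.rpow_le_rpow (by positivity) (not_le.mp h).le (by linarith)

end PolyTails

/-! ### Asymptotics and rates -/

section Asymptotic

/-- A positive definite inverse is a unit, which forces the covariance matrix to be invertible and
rules out the default value of `⁻¹`. -/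
theorem precision_mul_popCov {p : ℕ} {ν : Measure (Fin p → ℝ)} (h : (precision ν).PosDef) :
    precision ν * popCov ν = 1 := by
  refine Matrix.nonsing_inv_mul _ (Matrix.isUnit_nonsing_inv_det_iff.mp ?_)
  exact (Matrix.isUnit_iff_isUnit_det _).mp h.isUnit

/-- The error bounds fail only if the sample covariance matrix deviates from its target. -/
theorem measure_not_errorBounds_le {p n : ℕ} {Ω : Type*} [MeasurableSpace Ω] {P : Measure Ω}
    [IsProbabilityMeasure P] {ν : Measure (Fin p → ℝ)} (X : Fin n → Ω → Fin p → ℝ) (hp : 1 ≤ p)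
    {q s M L C : ℝ} (hq0 : 0 ≤ q) (hq1 : q < 1) (hA : MemSparseClass q s M (precision ν))
    (hL : 0 < L) (hC : 0 < C)
    (hsmall : s * M ^ (1 - 2 * q) * L ^ ((1 - q) / 2) ≤ 1 / (4 * C)) :
    P.real {ω | ¬ ErrorBounds (sampleCov (fun k => X k ω)) (C * M * √L) (precision ν)
      ((3 * C + 1) * M ^ 2 * √L) ((15 * C + 11) * s * M ^ (2 - 2 * q) * L ^ ((1 - q) / 2))}
      ≤ P.real {ω | ¬ ∀ i j, |sampleCov (fun k => X k ω) i j - popCov ν i j|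
        ≤ 2 * (C / 4 * √L)} := by
  refine measureReal_mono fun ω => ?_
  contrapose
  simp only [Set.mem_ofPred_eq, not_not]
  intro h
  refine errorBounds_of_close hp (isSymm_sampleCov _) (dotProduct_sampleCov_nonneg _) hq0 hq1 hA
    (precision_mul_popCov hA.posDef) hL hC (fun i j => (h i j).trans (le_of_eq (by ring))) ?_
  rw [le_div_iff₀ (by positivity)] at hsmall
  linarith

/-- The 2 in `τ + 2` pays for the union over p² entries. -/
theorem sq_mul_exp_neg_log_le {p : ℕ} (hp : 1 ≤ p) {τ a : ℝ} (ha : τ + 2 ≤ a) :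
    4 * (p : ℝ) ^ 2 * Real.exp (-(Real.log p * a)) ≤ 4 * (p : ℝ) ^ (-τ) := by
  have hp0 : (0 : ℝ) < p := by positivity
  have hlog : 0 ≤ Real.log p := Real.log_natCast_nonneg p
  have h1 : Real.exp (-(Real.log p * a)) ≤ (p : ℝ) ^ (-(τ + 2)) := by
    rw [Real.rpow_def_of_pos hp0, Real.exp_le_exp]
    have := mul_le_mul_of_nonneg_left ha hlog
    linarith
  calc 4 * (p : ℝ) ^ 2 * Real.exp (-(Real.log p * a))
      ≤ 4 * (p : ℝ) ^ 2 * (p : ℝ) ^ (-(τ + 2)) := by gcongr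
    _ = 4 * (p : ℝ) ^ (-τ) := by
      rw [mul_assoc, ← Real.rpow_natCast, ← Real.rpow_add hp0]
      congr 2; push_cast; ring

theorem log_dim_div_pos {p n : ℕ} (hp : 2 ≤ p) (hn : 1 ≤ n) : 0 < Real.log p / n :=
  div_pos (Real.log_pos (by exact_mod_cast hp)) (by positivity)

theorem nat_mul_sq_sqrt_log_div {p n : ℕ} (hn : 1 ≤ n) :
    n * √(Real.log p / n) ^ 2 = Real.log p := by
  have : 0 ≤ Real.log p / n := div_nonneg (Real.log_natCast_nonneg p) (by positivity)
  rw [Real.sq_sqrt this]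
  field_simp

theorem tendsto_sqrt_log_div {p : ℕ → ℕ}
    (h : (fun n : ℕ => Real.log (p n)) =o[atTop] (fun n : ℕ => (n : ℝ))) :
    Tendsto (fun n : ℕ => √(Real.log (p n) / n)) atTop (nhds 0) := by
  simpa using (h.tendsto_div_nhds_zero).sqrt

theorem eventually_mul_le {u : ℕ → ℝ} (hu : Tendsto u atTop (nhds 0)) (a : ℝ) {b : ℝ}
    (hb : 0 < b) : ∀ᶠ n in atTop, a * u n ≤ b := by
  have h := hu.const_mul a
  rw [mul_zero] at h
  exact h.eventually_le_const hb

theorem eventually_log_dim_le {p : ℕ → ℕ} {c γ ε : ℝ} (hp : ∀ n, 1 ≤ p n) (hc : 0 < c)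
    (hdim : ∀ n : ℕ, 1 ≤ n → (p n : ℝ) ≤ c * (n : ℝ) ^ γ) (hε : 0 < ε) :
    ∀ᶠ n : ℕ in atTop, Real.log (p n) ≤ (n : ℝ) ^ ε := by
  have h1 : (fun x : ℝ => Real.log c + γ * Real.log x) =o[atTop] fun x => x ^ ε := by
    refine IsLittleO.add ?_ ((isLittleO_log_rpow_atTop hε).const_mul_left γ)
    exact isLittleO_const_left.mpr (Or.inr (tendsto_norm_atTop_atTop.comp (tendsto_rpow_atTop hε)))
  have h2 := (h1.comp_tendsto tendsto_natCast_atTop_atTop).bound one_pos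
  filter_upwards [h2, eventually_ge_atTop 1] with n hn hn1
  have hn0 : (0 : ℝ) < n := by positivity
  have hp0 : (0 : ℝ) < p n := by have := hp n; positivity
  have h3 := Real.log_le_log hp0 (hdim n hn1)
  rw [Real.log_mul hc.ne' (by positivity), Real.log_rpow hn0] at h3
  simp only [Function.comp_apply, one_mul, Real.norm_eq_abs] at hn
  rw [abs_of_nonneg (show 0 ≤ (n : ℝ) ^ ε by positivity)] at hn
  exact (h3.trans (le_abs_self _)).trans hn

theorem isLittleO_log_dim {p : ℕ → ℕ} {c γ : ℝ} (hp : ∀ n, 1 ≤ p n) (hc : 0 < c)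
    (hdim : ∀ n : ℕ, 1 ≤ n → (p n : ℝ) ≤ c * (n : ℝ) ^ γ) :
    (fun n : ℕ => Real.log (p n)) =o[atTop] (fun n : ℕ => (n : ℝ)) := by
  have h1 : (fun n : ℕ => Real.log (p n)) =O[atTop] fun n : ℕ => (n : ℝ) ^ (1 / 2 : ℝ) := by
    refine IsBigO.of_bound 1 ?_
    filter_upwards [eventually_log_dim_le hp hc hdim (ε := 1 / 2) (by norm_num)] with n hn
    rw [Real.norm_of_nonneg (Real.log_natCast_nonneg _), Real.norm_of_nonneg (by positivity),
      one_mul]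
    exact hn
  refine h1.trans_isLittleO ?_
  have h2 : (fun x : ℝ => x ^ (1 / 2 : ℝ)) =o[atTop] fun x : ℝ => x := by
    refine isLittleO_of_tendsto' ((eventually_ne_atTop 0).mono fun x hx h => absurd h hx) ?_
    refine (tendsto_rpow_neg_atTop (show (0 : ℝ) < 1 / 2 by norm_num)).congr' ?_
    filter_upwards [eventually_gt_atTop 0] with x hx
    rw [eq_div_iff hx.ne', ← Real.rpow_add_one hx.ne']
    norm_num
  exact h2.comp_tendsto tendsto_natCast_atTop_atTop

/-- The truncation error is of order `n ^ (-(δ / 8))`. -/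
theorem truncation_probability_le {p n : ℕ} {c γ δ K α : ℝ} (hn : 1 ≤ n) (hγ : 0 < γ)
    (hc : 0 < c) (hδ : 0 < δ) (hK : 0 < K) (hα : α = 4 * γ + 4 + δ)
    (hdim : (p : ℝ) ≤ c * (n : ℝ) ^ γ) (hlog : Real.log p ≤ (n : ℝ) ^ (δ / (2 * α))) :
    n * p * (K * √(Real.log p / n) ^ (α / 2)) ≤ c * K * (n : ℝ) ^ (-(δ / 8)) := by
  have hn0 : (0 : ℝ) < n := by positivity
  have hα0 : 0 < α := by rw [hα]; positivity
  have hL0 : 0 ≤ Real.log p / n := div_nonneg (Real.log_natCast_nonneg p) hn0.le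
  -- The exponent is (δ/(2α) - 1) · α/4. As α/4 = γ + 1 + δ/4, the factor n p uses up γ + 1 and the
  -- logarithm half of the surplus δ/4, leaving δ/8.
  have h1 : √(Real.log p / n) ^ (α / 2) ≤ (n : ℝ) ^ (δ / 8 - α / 4) := by
    rw [Real.sqrt_eq_rpow, ← Real.rpow_mul hL0]
    have h2 : Real.log p / n ≤ (n : ℝ) ^ (δ / (2 * α) - 1) := by
      rw [Real.rpow_sub hn0, Real.rpow_one]
      gcongr
    refine (Real.rpow_le_rpow hL0 h2 (by positivity)).trans (le_of_eq ?_)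
    rw [← Real.rpow_mul hn0.le]
    congr 1
    field_simp
    ring
  calc n * p * (K * √(Real.log p / n) ^ (α / 2))
      ≤ n * (c * (n : ℝ) ^ γ) * (K * (n : ℝ) ^ (δ / 8 - α / 4)) := by gcongr
    _ = c * K * ((n : ℝ) ^ (1 : ℝ) * (n : ℝ) ^ γ * (n : ℝ) ^ (δ / 8 - α / 4)) := by
      rw [Real.rpow_one]; ring
    _ = c * K * (n : ℝ) ^ (-(δ / 8)) := by
      rw [← Real.rpow_add hn0, ← Real.rpow_add hn0, hα]
      congr 2; ring

end Asymptotic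

end SCIO

/-! ### Choice of constants and conclusion -/

theorem corollary1 :
    -- exponential-type tails
    (∀ η K : ℝ, 0 < η → 0 < K →
      ∃ C₀min : ℝ → ℝ, ∀ q : ℝ, 0 ≤ q → q < 1 → ∀ C₀ : ℝ, 0 < C₀ →
      ∃ C₁ C₂ : ℝ, 0 < C₁ ∧ 0 < C₂ ∧
      ∀ τ : ℝ, 0 < τ → C₀min τ ≤ C₀ →
      ∀ (p : ℕ → ℕ) (s M : ℕ → ℝ) (ν : ∀ n, Measure (Fin (p n) → ℝ))
        (Ω : ℕ → Type*) [∀ n, MeasurableSpace (Ω n)] (P : ∀ n, Measure (Ω n))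
        (X : ∀ n, Fin n → Ω n → Fin (p n) → ℝ),
        (∀ n, 1 ≤ p n) →
        (∀ n, IsProbabilityMeasure (ν n)) →
        (∀ n, IsProbabilityMeasure (P n)) →
        (∀ n, SCIO.IsIIDSample (P n) (ν n) (X n)) →
        SCIO.SparsityCondition q p s M ν →
        SCIO.ExpTails η K p ν →
        (fun n : ℕ => (P n).real {ω | ¬ SCIO.ErrorBounds
            (SCIO.sampleCov (fun k => X n k ω))
            (C₀ * M n * √(Real.log (p n) / n))
            (SCIO.precision (ν n))
            (C₁ * M n ^ 2 * √(Real.log (p n) / n))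
            (C₂ * s n * M n ^ (2 - 2 * q) * (Real.log (p n) / n) ^ ((1 - q) / 2))})
          =O[atTop] (fun n : ℕ => (p n : ℝ) ^ (-τ))) ∧
    -- polynomial-type tails
    (∀ δ K : ℝ, 0 < δ → 0 < K →
      ∃ C₀min : ℝ → ℝ → ℝ → ℝ, ∀ q : ℝ, 0 ≤ q → q < 1 → ∀ C₀ : ℝ, 0 < C₀ →
      ∃ C₁ C₂ : ℝ, 0 < C₁ ∧ 0 < C₂ ∧
      ∀ τ γ c : ℝ, 0 < τ → 0 < γ → 0 < c → C₀min τ γ c ≤ C₀ →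
      ∀ (p : ℕ → ℕ) (s M : ℕ → ℝ) (ν : ∀ n, Measure (Fin (p n) → ℝ))
        (Ω : ℕ → Type*) [∀ n, MeasurableSpace (Ω n)] (P : ∀ n, Measure (Ω n))
        (X : ∀ n, Fin n → Ω n → Fin (p n) → ℝ),
        (∀ n, 1 ≤ p n) →
        (∀ n, IsProbabilityMeasure (ν n)) →
        (∀ n, IsProbabilityMeasure (P n)) →
        (∀ n, SCIO.IsIIDSample (P n) (ν n) (X n)) →
        SCIO.SparsityCondition q p s M ν →
        SCIO.PolyTails γ c δ K p ν →
        (fun n : ℕ => (P n).real {ω | ¬ SCIO.ErrorBounds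
            (SCIO.sampleCov (fun k => X n k ω))
            (C₀ * M n * √(Real.log (p n) / n))
            (SCIO.precision (ν n))
            (C₁ * M n ^ 2 * √(Real.log (p n) / n))
            (C₂ * s n * M n ^ (2 - 2 * q) * (Real.log (p n) / n) ^ ((1 - q) / 2))})
          =O[atTop] (fun n : ℕ => (p n : ℝ) ^ (-τ) + (n : ℝ) ^ (-(δ / 8)))) := by
  refine ⟨fun η K hη hK => ?_, fun δ K hδ hK => ?_⟩
  · set v := (2 / η * Real.exp (η / 2) + 16 / η ^ 2) * K
    -- The deviation constant is C₀/4, so the Chernoff exponent is (C₀/4 - v) log p, and C₀/4 - v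
    -- must reach τ + 2.
    refine ⟨fun τ => 4 * (v + τ + 2), fun q hq0 hq1 C₀ hC₀ =>
      ⟨3 * C₀ + 1, 15 * C₀ + 11, by positivity, by positivity, ?_⟩⟩
    intro τ _ hCmin p s M ν Ω _ P X hp hν hP hX hS hT
    refine IsBigO.of_bound 4 ?_
    have hr := SCIO.tendsto_sqrt_log_div hT.log_dim
    filter_upwards [eventually_ge_atTop 1, hS.small.eventually_le_const
      (show 0 < 1 / (4 * C₀) by positivity), SCIO.eventually_mul_le hr (C₀ / 4) one_pos,
      SCIO.eventually_mul_le hr 1 (half_pos hη)] with n hn hsp hr1 hr2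
    have := hν n
    have := hP n
    rw [Real.norm_of_nonneg measureReal_nonneg, Real.norm_of_nonneg (by positivity)]
    -- For p = 1 the logarithm, hence `lam`, vanishes, but the claimed rate is p^(-τ) = 1 and the
    -- bound is trivial.
    rcases (hp n).eq_or_lt with h1 | h2
    · refine measureReal_le_one.trans ?_
      rw [← h1]; norm_num
    · refine (SCIO.measure_not_errorBounds_le (X n) (hp n) hq0 hq1 (hS.mem n)
        (SCIO.log_dim_div_pos h2 hn) hC₀ hsp).trans ?_
      refine (SCIO.measure_sampleCov_deviation_le_of_exp (hX n) hn hη hK (hT.integrable n)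
        (hT.moment n) (Real.sqrt_nonneg _) (by linarith) hr1).trans ?_
      rw [SCIO.nat_mul_sq_sqrt_log_div hn]
      exact SCIO.sq_mul_exp_neg_log_le (hp n) (by linarith)
  · refine ⟨fun τ _ _ => 4 * (5 * (1 + K) + τ + 2), fun q hq0 hq1 C₀ hC₀ =>
      ⟨3 * C₀ + 1, 15 * C₀ + 11, by positivity, by positivity, ?_⟩⟩
    intro τ γ c _ hγ hc hCmin p s M ν Ω _ P X hp hν hP hX hS hT
    refine IsBigO.of_bound (4 + c * K) ?_
    have hr := SCIO.tendsto_sqrt_log_div (SCIO.isLittleO_log_dim hp hc hT.dim)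
    filter_upwards [eventually_ge_atTop 1, hS.small.eventually_le_const
      (show 0 < 1 / (4 * C₀) by positivity), SCIO.eventually_mul_le hr (C₀ / 4) one_pos,
      SCIO.eventually_mul_le hr 1 one_pos, SCIO.eventually_log_dim_le hp hc hT.dim
      (show 0 < δ / (2 * (4 * γ + 4 + δ)) by positivity)] with n hn hsp hr1 hr2 hlog
    have := hν n
    have := hP n
    have hb : 0 ≤ (n : ℝ) ^ (-(δ / 8)) := by positivity
    have ha : 0 ≤ (p n : ℝ) ^ (-τ) := by positivity
    have hcK : 0 < c * K := by positivity
    rw [Real.norm_of_nonneg measureReal_nonneg, Real.norm_of_nonneg (by positivity)]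
    rcases (hp n).eq_or_lt with h1 | h2
    · refine measureReal_le_one.trans ?_
      rw [← h1, Nat.cast_one, Real.one_rpow]
      nlinarith
    · have hL := SCIO.log_dim_div_pos h2 hn
      refine (SCIO.measure_not_errorBounds_le (X n) (hp n) hq0 hq1 (hS.mem n) hL hC₀ hsp).trans ?_
      have h := SCIO.measure_sampleCov_deviation_le_of_poly (C := C₀ / 4 - 2 * (1 + K)) (hX n) hn
        (by linarith) hK (hT.integrable n) (hT.moment n) (Real.sqrt_pos.mpr hL) (by linarith)
        (by rwa [sub_add_cancel])
      rw [sub_add_cancel, SCIO.nat_mul_sq_sqrt_log_div hn] at h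
      refine h.trans ?_
      have h3 := SCIO.sq_mul_exp_neg_log_le (hp n) (τ := τ)
        (a := C₀ / 4 - 2 * (1 + K) - 3 * (1 + K)) (by linarith)
      have h4 := SCIO.truncation_probability_le hn hγ hc hδ hK rfl (hT.dim n hn) hlog
      nlinarith [mul_nonneg hcK.le ha]
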